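/- Let $n\ge 1$, let $\mathcal S_n$ be the set of real symmetric $n\times n$ matrices and let $\Delta_n=\{X\in\mathcal S_n : X\succeq 0,\ \operatorname{tr}X=1\}$ be the spectrahedron. Write $\langle A,B\rangle=\operatorname{tr}(A^TB)$ for the Frobenius inner product and $\|A\|_\infty$ for the Euclidean operator norm. Let $u$ be uniformly distributed on the unit sphere of $\mathbb R^n$, and for $Y,Y'\in\mathcal S_n$ put $$\bar P(Y)=\mathbb E_u\left[\frac{e^{Y/2}uu^Te^{Y/2}}{u^Te^Yu}\right],\qquad \bar p(Y)=\mathbb E_u\left[\log\left(u^Te^Yu\right)\right],$$ $$\bar V_Y(Y')=\bar p(Y')-\bar p(Y)-\langle Y'-Y,\bar P(Y)\rangle .$$ Then: 1. (Smoothness) For all $Y,D\in\mathcal S_n$, $\bar V_Y(Y+D)\le \tfrac32\|D\|_\infty^2$. 2. (Refined smoothness for positive shifts) For all $Y,D\in\mathcal S_n$ with $D\succeq 0$ and $\|D\|_\infty\le \tfrac16$, $\bar V_Y(Y+D)\le 3\|D\|_\infty\langle D,\bar P(Y)\rangle$. 3. (Diameter bound) For all $Y,Y'\in\mathcal S_n$,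 $\bar V_Y(0)-\bar V_Y(Y')\le\log(4n)$. 4. (Surjectivity) For every $X$ in the relative interior of $\Delta_n$ (its interior relative to its affine hull) there is $Y\in\mathcal S_n$ with $\bar P(Y)=X$. -/

import Mathlib

open MeasureTheory
open scoped Matrix

noncomputable section

namespace AvgMirror

/-- The unit sphere of Euclidean space `ℝⁿ`. -/
abbrev UnitSphere (n : ℕ) : Type :=
  Metric.sphere (0 : EuclideanSpace ℝ (Fin n)) 1

/-- The uniform distribution on the unit sphere of `ℝⁿ`: the surface measure induced by Lebesgue
measure, normalized to total mass one. -/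
def uniformSphere (n : ℕ) : Measure (UnitSphere n) :=
  ((volume : Measure (EuclideanSpace ℝ (Fin n))).toSphere Set.univ)⁻¹ •
    (volume : Measure (EuclideanSpace ℝ (Fin n))).toSphere

/-- The coordinate vector of a point of the sphere. -/
def coords {n : ℕ} (u : UnitSphere n) : Fin n → ℝ :=
  (u : EuclideanSpace ℝ (Fin n)).ofLp

/-- The Frobenius inner product `⟨A, B⟩ = tr (Aᵀ B)`. -/
def frobInner {n : ℕ} (A B : Matrix (Fin n) (Fin n) ℝ) : ℝ :=
  (Aᵀ * B).trace

/-- The Euclidean operator norm `‖A‖_∞` (Schatten `∞`-norm). -/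
def opNorm {n : ℕ} (A : Matrix (Fin n) (Fin n) ℝ) : ℝ :=
  ‖Matrix.toEuclideanCLM (n := Fin n) (𝕜 := ℝ) A‖

/-- The spectrahedron: positive semidefinite symmetric matrices of trace one. -/
def spectrahedron (n : ℕ) : Set (Matrix (Fin n) (Fin n) ℝ) :=
  {X | X.PosSemidef ∧ X.trace = 1}

/-- The quadratic form `uᵀ e^Y u`. -/
def expForm {n : ℕ} (Y : Matrix (Fin n) (Fin n) ℝ) (u : Fin n → ℝ) : ℝ :=
  u ⬝ᵥ (NormedSpace.exp Y *ᵥ u)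

/-- The randomized mirror projection `P_u(Y) = e^{Y/2} u uᵀ e^{Y/2} / (uᵀ e^Y u)`. -/
def randProj {n : ℕ} (u : Fin n → ℝ) (Y : Matrix (Fin n) (Fin n) ℝ) :
    Matrix (Fin n) (Fin n) ℝ :=
  (expForm Y u)⁻¹ •
    (NormedSpace.exp ((1 / 2 : ℝ) • Y) * Matrix.vecMulVec u u * NormedSpace.exp ((1 / 2 : ℝ) • Y))

/-- The average mirror projection `P̄(Y) = E_u P_u(Y)`, `u` uniform on the unit sphere (the
expectation of a matrix is taken entrywise). -/
def avgProj {n : ℕ} (Y : Matrix (Fin n) (Fin n) ℝ) : Matrix (Fin n) (Fin n) ℝ :=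
  Matrix.of fun i j => ∫ u, randProj (coords u) Y i j ∂(uniformSphere n)

/-- The potential `p̄(Y) = E_u log (uᵀ e^Y u)`, `u` uniform on the unit sphere. -/
def avgPot {n : ℕ} (Y : Matrix (Fin n) (Fin n) ℝ) : ℝ :=
  ∫ u, Real.log (expForm Y (coords u)) ∂(uniformSphere n)

/-- The Bregman divergence `V̄_Y(Y') = p̄(Y') - p̄(Y) - ⟨Y' - Y, P̄(Y)⟩`. -/
def bregman {n : ℕ} (Y Y' : Matrix (Fin n) (Fin n) ℝ) : ℝ :=
  avgPot Y' - avgPot Y - frobInner (Y' - Y) (avgProj Y)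

end AvgMirror

end

/-! The potential `p̄` is smooth, invariant under `Y ↦ U Y Uᵀ` for orthogonal `U`, and has gradient
`P̄`. At `Y = diag l`, `P̄(Y)` is diagonal with entries `avgWeight l`, the averages `w` of the
softmax weights `e^{l i} u_i² / ∑ e^{l k} u_k²`. These are nonnegative and sum to one, so `⟨B,
P̄(Y)⟩` is an average of values of the form of `B` at unit vectors.

Parts 1 and 2 rest on the Hessian bound `p̄''(Y)[D, D] ≤ 2 ⟨P̄(Y), D²⟩` (`hessPot_le`), proved at
diagonal `Y`. In diagonal directions it comes from `log x ≤ x - 1`. Off the diagonal,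
differentiating `[Y, P̄(Y)] = 0` shows that the Hessian acts on entry `(i, j)` by the divided
difference `(w i - w j) / (l i - l j)`, and averaging over the swap of coordinates `i` and `j`
bounds this by `w i + w j` (`avgWeight_sub_le`). Repeated eigenvalues are reached by continuity.
Since `⟨P̄(Y), D²⟩ ≤ ‖D‖²`, Taylor's formula gives part 1, even with constant 1. For `D ≽ 0` one has
`D² ≼ ‖D‖ D`, so the derivative `g'` along the segment satisfies `g'' ≤ 2 ‖D‖ g'`, and Grönwall
gives part 2.

In part 3 the difference of divergences equals `⟨Y', P̄(Y)⟩ - p̄(Y')`, which is at most `λ_max(Y') -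
p̄(Y')`. A Gaussian computation of `E log u_i²` bounds this by `log (4 n)` (`le_avgPot_diagonal`).

For part 4, `p̄(Y) - ⟨X, Y⟩` is constant along the identity, so `(tr Y)² / 2` is added. Positive
definiteness of `X` and part 3's eigenvalue bound make the sum coercive on symmetric matrices; at a
minimizer the trace vanishes and the gradient equation reads `P̄(Y) = X`. -/

open MeasureTheory
open scoped Matrix

noncomputable section

namespace AvgMirror

/-! ### Smooth dependence of integrals on a parameter. -/

section ParametricIntegral

variable {E V : Type} [NormedAddCommGroup E] [NormedSpace ℝ E] [FiniteDimensional ℝ E]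
  [NormedAddCommGroup V] [NormedSpace ℝ V]
  {K : Type} [TopologicalSpace K] [CompactSpace K] [MeasurableSpace K] [BorelSpace K]
  [SecondCountableTopology K] {μ : Measure K} [IsFiniteMeasure μ]

/-- Integrating a smooth family over a compact parameter space gives a smooth function. -/
theorem contDiff_integral_of_contDiffOn {c : K → V} (hc : Continuous c) {W : Set V}
    (hW : IsOpen W) (hcW : ∀ k, c k ∈ W) (m : ℕ) :
    ∀ {G : Type} [NormedAddCommGroup G] [NormedSpace ℝ G] {g : E × V → G},
      ContDiffOn ℝ m g (Set.univ ×ˢ W) → ContDiff ℝ m fun Y => ∫ k, g (Y, c k) ∂μ := by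
  have hcont : ∀ {G : Type} [NormedAddCommGroup G] {g : E × V → G},
      ContinuousOn g (Set.univ ×ˢ W) → Continuous fun p : E × K => g (p.1, c p.2) := by
    intro G _ g hg
    exact hg.comp_continuous (by fun_prop) fun p => ⟨trivial, hcW _⟩
  have hO : IsOpen (Set.univ ×ˢ W : Set (E × V)) := isOpen_univ.prod hW
  -- `G` stays quantified because the inductive step applies the hypothesis to the partial
  -- derivative, which takes values in `E →L[ℝ] G`.
  induction m with
  | zero =>
    intro G _ _ g hg
    have := FiniteDimensional.proper ℝ E
    have h := continuous_parametric_integral_of_continuous (μ := μ)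
      (f := fun Y k => g (Y, c k)) (hcont hg.continuousOn) isCompact_univ
    simp only [setIntegral_univ] at h
    exact contDiff_zero.2 h
  | succ m ih =>
    intro G _ _ g hg
    have hd : ∀ p ∈ (Set.univ ×ˢ W : Set (E × V)), DifferentiableAt ℝ g p := fun p hp =>
      (hg.contDiffAt (hO.mem_nhds hp)).differentiableAt (by simp)
    let g' : E × V → E →L[ℝ] G := fun p => (fderiv ℝ g p).comp (ContinuousLinearMap.inl ℝ E V)
    have hg' : ContDiffOn ℝ m g' (Set.univ ×ˢ W) := by
      have h1 : ContDiffOn ℝ m (fderiv ℝ g) (Set.univ ×ˢ W) :=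
        hg.fderiv_of_isOpen hO (by simp)
      exact h1.clm_comp contDiffOn_const
    have hder : ∀ Y k, HasFDerivAt (fun Y => g (Y, c k)) (g' (Y, c k)) Y := by
      intro Y k
      have h1 := (hd (Y, c k) ⟨trivial, hcW k⟩).hasFDerivAt
      exact h1.comp Y (hasFDerivAt_prodMk_left Y (c k))
    have hgc := hcont hg.continuousOn
    have hgc' := hcont hg'.continuousOn
    refine contDiff_succ_iff_hasFDerivAt.2 ⟨fun Y => ∫ k, g' (Y, c k) ∂μ, ih hg', fun Y => ?_⟩
    have := FiniteDimensional.proper ℝ E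
    -- The derivative is bounded on the compact set `closedBall Y 1 × K`, which supplies a constant
    -- dominating function.
    obtain ⟨C, hC⟩ :=
      ((isCompact_closedBall Y 1).prod (isCompact_univ (X := K))).exists_bound_of_continuousOn
      hgc'.continuousOn
    have hs : ∀ Z, Continuous fun k => g (Z, c k) := fun Z => by
      have := hgc.comp (Continuous.prodMk_right Z)
      exact this
    have hs' : Continuous fun k => g' (Y, c k) := hgc'.comp (Continuous.prodMk_right Y)
    refine hasFDerivAt_integral_of_dominated_of_fderiv_le (bound := fun _ => C)
      (F' := fun Y k => g' (Y, c k))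
      (Metric.closedBall_mem_nhds Y one_pos)
      (.of_forall fun Z => (hs Z).aestronglyMeasurable)
      ((hs Y).integrable_of_hasCompactSupport (HasCompactSupport.of_compactSpace _))
      hs'.aestronglyMeasurable (.of_forall fun k Z hZ => hC (Z, k) ⟨hZ, trivial⟩)
      (integrable_const _) (.of_forall fun k Z _ => hder Z k)

end ParametricIntegral

/-! ### The uniform distribution on the sphere and its Gaussian model. -/

variable {n : ℕ}

lemma isProbabilityMeasure_uniformSphere (hn : 1 ≤ n) :
    IsProbabilityMeasure (uniformSphere n) := by
  have : Nonempty (Fin n) := ⟨⟨0, hn⟩⟩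
  refine ⟨?_⟩
  rw [uniformSphere, Measure.smul_apply, smul_eq_mul]
  refine ENNReal.inv_mul_cancel ?_ (measure_ne_top _ _)
  rw [ne_eq, Measure.measure_univ_eq_zero]
  exact Measure.toSphere_ne_zero _

instance isFiniteMeasure_uniformSphere : IsFiniteMeasure (uniformSphere n) := by
  rcases Nat.eq_zero_or_pos n with rfl | hn
  · rw [uniformSphere]
    have : IsEmpty (UnitSphere 0) := ⟨fun u => by
      have h := u.2
      rw [Subsingleton.elim (u : EuclideanSpace ℝ (Fin 0)) 0] at h
      simp at h⟩
    exact ⟨by simp [Set.univ_eq_empty_iff.2 this]⟩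
  · have := isProbabilityMeasure_uniformSphere hn
    infer_instance

@[fun_prop]
lemma continuous_coords : Continuous (coords (n := n)) :=
  (PiLp.continuous_ofLp 2 (fun _ : Fin n => ℝ)).comp continuous_subtype_val

lemma sum_coords_sq (u : UnitSphere n) : ∑ i, coords u i ^ 2 = 1 := by
  have h : ‖(u : EuclideanSpace ℝ (Fin n))‖ = 1 := by simp
  have h2 := EuclideanSpace.norm_sq_eq (u : EuclideanSpace ℝ (Fin n))
  rw [h] at h2
  simpa [coords] using h2.symm

lemma coords_ne_zero (u : UnitSphere n) : coords u ≠ 0 := by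
  intro h
  have := sum_coords_sq u
  simp [h] at this

/-- The law of `x / |x|` for a Gaussian vector `x` is the uniform distribution on the sphere. -/
lemma integral_uniformSphere_mul_gaussian (hn : 1 ≤ n) (f : (Fin n → ℝ) → ℝ) :
    (∫ u, f (coords u) ∂(uniformSphere n)) *
        (∫ x : EuclideanSpace ℝ (Fin n), Real.exp (-‖x‖ ^ 2)) =
      ∫ x : EuclideanSpace ℝ (Fin n), f (‖x‖⁻¹ • x.ofLp) * Real.exp (-‖x‖ ^ 2) := by
  have : Nonempty (Fin n) := ⟨⟨0, hn⟩⟩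
  -- Polar coordinates split off a radial factor independent of `g`; the case `g = 1` below
  -- eliminates it.
  have key : ∀ g : (Fin n → ℝ) → ℝ,
      ∫ x : EuclideanSpace ℝ (Fin n), g (‖x‖⁻¹ • x.ofLp) * Real.exp (-‖x‖ ^ 2) =
        (∫ u, g (coords u) ∂(volume : Measure (EuclideanSpace ℝ (Fin n))).toSphere) *
        ∫ r : Set.Ioi (0 : ℝ), Real.exp (-(r : ℝ) ^ 2)
          ∂(Measure.volumeIoiPow (Module.finrank ℝ (EuclideanSpace ℝ (Fin n)) - 1)) := by
    intro g
    rw [← integral_prod_mul, ← Measure.measurePreserving_homeomorphUnitSphereProd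
      (volume : Measure (EuclideanSpace ℝ (Fin n))) |>.integral_comp
      (Homeomorph.measurableEmbedding _)]
    simp only [homeomorphUnitSphereProd_apply_snd_coe, coords,
      homeomorphUnitSphereProd_apply_fst_coe]
    nth_rw 1 [← restrict_compl_singleton (μ := volume) (0 : EuclideanSpace ℝ (Fin n))]
    rw [← integral_subtype_comap (measurableSet_singleton _).compl]
    rfl
  have h1 := key (fun _ => 1)
  simp only [one_mul, integral_const, smul_eq_mul, mul_one] at h1
  have hne : (volume : Measure (EuclideanSpace ℝ (Fin n))).toSphere.real Set.univ ≠ 0 := by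
    rw [ne_eq, measureReal_eq_zero_iff, Measure.measure_univ_eq_zero]
    exact Measure.toSphere_ne_zero _
  rw [key f, h1, uniformSphere, integral_smul_measure, ENNReal.toReal_inv, ← measureReal_def,
    smul_eq_mul]
  field_simp

lemma integral_exp_neg_norm_sq : ∫ x : EuclideanSpace ℝ (Fin n), Real.exp (-‖x‖ ^ 2) =
    √Real.pi ^ n := by
  have h := GaussianFourier.integral_rexp_neg_mul_sq_norm (V := EuclideanSpace ℝ (Fin n)) one_pos
  simp only [neg_mul, one_mul, div_one, finrank_euclideanSpace, Fintype.card_fin] at h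
  rw [h, Real.sqrt_eq_rpow, ← Real.rpow_mul_natCast Real.pi_pos.le]
  ring_nf

lemma integral_exp_neg_norm_sq_pos : 0 < ∫ x : EuclideanSpace ℝ (Fin n), Real.exp (-‖x‖ ^ 2) := by
  rw [integral_exp_neg_norm_sq]
  have := Real.pi_pos
  positivity

/-- The Bochner integral of a non-integrable function is `0`, so a nonzero value proves
integrability. -/
lemma integrable_gaussian :
    Integrable fun x : EuclideanSpace ℝ (Fin n) => Real.exp (-‖x‖ ^ 2) :=
  not_imp_comm.1 integral_undef integral_exp_neg_norm_sq_pos.ne'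

/-- The uniform distribution on the sphere is invariant under orthogonal matrices. -/
lemma integral_comp_mulVec (hn : 1 ≤ n) {U : Matrix (Fin n) (Fin n) ℝ}
    (hU : U ∈ Matrix.orthogonalGroup (Fin n) ℝ) (f : (Fin n → ℝ) → ℝ) :
    ∫ u, f (U *ᵥ coords u) ∂(uniformSphere n) = ∫ u, f (coords u) ∂(uniformSphere n) := by
  apply mul_right_cancel₀ (integral_exp_neg_norm_sq_pos (n := n)).ne'
  rw [integral_uniformSphere_mul_gaussian hn (fun v => f (U *ᵥ v)),
    integral_uniformSphere_mul_gaussian hn f]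
  -- `U` acts as a linear isometry, which preserves both Lebesgue measure and the norm in the
  -- Gaussian weight.
  let e : EuclideanSpace ℝ (Fin n) ≃ₗᵢ[ℝ] EuclideanSpace ℝ (Fin n) :=
    Unitary.linearIsometryEquiv
      ⟨Matrix.toEuclideanCLM (n := Fin n) (𝕜 := ℝ) U, Unitary.map_mem _ hU⟩
  have he : ∀ x, (e x).ofLp = U *ᵥ x.ofLp := fun x => rfl
  rw [← e.measurePreserving.integral_comp e.toHomeomorph.measurableEmbedding
    (fun x => f (‖x‖⁻¹ • x.ofLp) * Real.exp (-‖x‖ ^ 2))]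
  simp [he, Matrix.mulVec_smul]

/-! ### Positivity of the exponential form and smoothness of the potential. -/

lemma isSymm_exp {Y : Matrix (Fin n) (Fin n) ℝ} (hY : Y.IsSymm) : (NormedSpace.exp Y).IsSymm := by
  rw [Matrix.IsSymm, ← Matrix.exp_transpose, hY.eq]

lemma exp_half_mul_exp_half (Y : Matrix (Fin n) (Fin n) ℝ) :
    NormedSpace.exp ((1 / 2 : ℝ) • Y) * NormedSpace.exp ((1 / 2 : ℝ) • Y) = NormedSpace.exp Y := by
  rw [← Matrix.exp_add_of_commute _ _ (Commute.refl _), ← add_smul]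
  norm_num

/-- The form is `|e^{Y/2} u|²`, and `e^{Y/2}` is invertible. -/
lemma expForm_pos {Y : Matrix (Fin n) (Fin n) ℝ} (hY : Y.IsSymm) {u : Fin n → ℝ} (hu : u ≠ 0) :
    0 < expForm Y u := by
  have hs : (NormedSpace.exp ((1 / 2 : ℝ) • Y)).IsSymm := isSymm_exp (hY.smul _)
  have hv : NormedSpace.exp ((1 / 2 : ℝ) • Y) *ᵥ u ≠ 0 := by
    intro h
    apply hu
    have := Matrix.isUnit_exp ((1 / 2 : ℝ) • Y)
    exact Matrix.mulVec_injective_of_isUnit this (by simpa using h)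
  have : expForm Y u = (NormedSpace.exp ((1 / 2 : ℝ) • Y) *ᵥ u) ⬝ᵥ
      (NormedSpace.exp ((1 / 2 : ℝ) • Y) *ᵥ u) := by
    rw [expForm, ← exp_half_mul_exp_half, ← Matrix.mulVec_mulVec, Matrix.dotProduct_mulVec,
      ← Matrix.mulVec_transpose, hs.eq]
  rw [this]
  have h0 : 0 ≤ (NormedSpace.exp ((1 / 2 : ℝ) • Y) *ᵥ u) ⬝ᵥ
      (NormedSpace.exp ((1 / 2 : ℝ) • Y) *ᵥ u) := by
    simpa using dotProduct_star_self_nonneg (NormedSpace.exp ((1 / 2 : ℝ) • Y) *ᵥ u)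
  refine lt_of_le_of_ne h0 (Ne.symm ?_)
  rwa [ne_eq, dotProduct_self_eq_zero]

/-- The symmetric part of a matrix. -/
def symPart (Y : Matrix (Fin n) (Fin n) ℝ) : Matrix (Fin n) (Fin n) ℝ := (1 / 2 : ℝ) • (Y + Yᵀ)

lemma isSymm_symPart (Y : Matrix (Fin n) (Fin n) ℝ) : (symPart Y).IsSymm := by
  simp [symPart, Matrix.IsSymm, add_comm]

lemma symPart_eq {Y : Matrix (Fin n) (Fin n) ℝ} (hY : Y.IsSymm) : symPart Y = Y := by
  rw [symPart, hY.eq, ← two_smul ℝ Y, smul_smul]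
  norm_num

/-- The potential `p̄`, extended to all matrices through the symmetric part. -/
def symPot (Y : Matrix (Fin n) (Fin n) ℝ) : ℝ := avgPot (symPart Y)

lemma symPot_eq {Y : Matrix (Fin n) (Fin n) ℝ} (hY : Y.IsSymm) : symPot Y = avgPot Y := by
  rw [symPot, symPart_eq hY]

section Norm

open scoped Matrix.Norms.Operator

/-- Passing to the symmetric part keeps the form positive for every matrix, so the logarithm is
smooth on the whole matrix space and derivatives along non-symmetric matrix units make sense. -/
theorem contDiff_symPot (m : ℕ) : ContDiff ℝ m (symPot (n := n)) := by
  have hexp : ContDiff ℝ m (NormedSpace.exp : Matrix (Fin n) (Fin n) ℝ → _) :=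
    contDiff_iff_contDiffAt.2 fun x => (NormedSpace.exp_analytic (𝕂 := ℝ) x).contDiffAt
  have hsym : ContDiff ℝ m (symPart (n := n)) := by
    let T : Matrix (Fin n) (Fin n) ℝ →ₗ[ℝ] Matrix (Fin n) (Fin n) ℝ :=
      (1 / 2 : ℝ) • (LinearMap.id + (Matrix.transposeLinearEquiv (Fin n) (Fin n) ℝ ℝ).toLinearMap)
    exact (LinearMap.toContinuousLinearMap T).contDiff
  have hent : ∀ i j, ContDiff ℝ m fun Y : Matrix (Fin n) (Fin n) ℝ =>
      NormedSpace.exp (symPart Y) i j := by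
    intro i j
    have := (LinearMap.toContinuousLinearMap (Matrix.entryLinearMap ℝ ℝ i j)).contDiff (n := m)
    exact this.comp (hexp.comp hsym)
  have hform : ContDiff ℝ m fun p : Matrix (Fin n) (Fin n) ℝ × (Fin n → ℝ) =>
      expForm (symPart p.1) p.2 := by
    simp only [expForm, dotProduct, Matrix.mulVec]
    have hent' : ∀ i j, ContDiff ℝ m fun p : Matrix (Fin n) (Fin n) ℝ × (Fin n → ℝ) =>
      NormedSpace.exp (symPart p.1) i j := fun i j => (hent i j).comp contDiff_fst
    fun_prop
  refine contDiff_integral_of_contDiffOn (μ := uniformSphere n) (continuous_coords (n := n))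
    (W := {0}ᶜ) isOpen_compl_singleton coords_ne_zero m
    (g := fun p : Matrix (Fin n) (Fin n) ℝ × (Fin n → ℝ) => Real.log (expForm (symPart p.1) p.2)) ?_
  exact hform.contDiffOn.log fun p hp => (expForm_pos (isSymm_symPart _) hp.2).ne'

end Norm

/-! ### Orthogonal equivariance. -/

lemma exp_orthogonal_conj {U : Matrix (Fin n) (Fin n) ℝ} (hU : U ∈ Matrix.orthogonalGroup (Fin n) ℝ)
    (Y : Matrix (Fin n) (Fin n) ℝ) :
    NormedSpace.exp (U * Y * Uᵀ) = U * NormedSpace.exp Y * Uᵀ := by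
  have h1 : U * Uᵀ = 1 := by simpa using (Matrix.mem_orthogonalGroup_iff (Fin n) ℝ).1 hU
  have hinv : U⁻¹ = Uᵀ := Matrix.inv_eq_right_inv h1
  have hu : IsUnit U := IsUnit.of_mul_eq_one _ h1
  rw [← hinv, Matrix.exp_conj U Y hu]

lemma transpose_mem_orthogonalGroup {U : Matrix (Fin n) (Fin n) ℝ}
    (hU : U ∈ Matrix.orthogonalGroup (Fin n) ℝ) : Uᵀ ∈ Matrix.orthogonalGroup (Fin n) ℝ := by
  rw [Matrix.mem_orthogonalGroup_iff']  at *
  simpa [Matrix.star_eq_conjTranspose] using mul_eq_one_comm.1 hU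

lemma orthogonal_mul_transpose {U : Matrix (Fin n) (Fin n) ℝ}
    (hU : U ∈ Matrix.orthogonalGroup (Fin n) ℝ) : U * Uᵀ = 1 := by
  simpa using (Matrix.mem_orthogonalGroup_iff (Fin n) ℝ).1 hU

lemma orthogonal_transpose_mul {U : Matrix (Fin n) (Fin n) ℝ}
    (hU : U ∈ Matrix.orthogonalGroup (Fin n) ℝ) : Uᵀ * U = 1 :=
  mul_eq_one_comm.1 (orthogonal_mul_transpose hU)

lemma expForm_conj {U : Matrix (Fin n) (Fin n) ℝ} (hU : U ∈ Matrix.orthogonalGroup (Fin n) ℝ)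
    (Y : Matrix (Fin n) (Fin n) ℝ) (u : Fin n → ℝ) :
    expForm (U * Y * Uᵀ) u = expForm Y (Uᵀ *ᵥ u) := by
  rw [expForm, exp_orthogonal_conj hU, expForm, ← Matrix.mulVec_mulVec, ← Matrix.mulVec_mulVec,
    Matrix.dotProduct_mulVec, ← Matrix.mulVec_transpose]

lemma randProj_conj {U : Matrix (Fin n) (Fin n) ℝ} (hU : U ∈ Matrix.orthogonalGroup (Fin n) ℝ)
    (Y : Matrix (Fin n) (Fin n) ℝ) (u : Fin n → ℝ) :
    randProj u (U * Y * Uᵀ) = U * randProj (Uᵀ *ᵥ u) Y * Uᵀ := by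
  have h : (1 / 2 : ℝ) • (U * Y * Uᵀ) = U * ((1 / 2 : ℝ) • Y) * Uᵀ := by simp
  have h2 : Matrix.vecMulVec (Uᵀ *ᵥ u) (Uᵀ *ᵥ u) = Uᵀ * Matrix.vecMulVec u u * U := by
    rw [Matrix.mul_vecMulVec, Matrix.vecMulVec_mul, ← Matrix.mulVec_transpose]
  rw [randProj, expForm_conj hU, h, exp_orthogonal_conj hU, randProj, h2]
  simp [Matrix.mul_assoc]

lemma avgPot_conj (hn : 1 ≤ n) {U : Matrix (Fin n) (Fin n) ℝ}
    (hU : U ∈ Matrix.orthogonalGroup (Fin n) ℝ) (Y : Matrix (Fin n) (Fin n) ℝ) :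
    avgPot (U * Y * Uᵀ) = avgPot Y := by
  simp only [avgPot, expForm_conj hU]
  exact integral_comp_mulVec hn (transpose_mem_orthogonalGroup hU) fun v => Real.log (expForm Y v)

lemma symPart_conj (U Y : Matrix (Fin n) (Fin n) ℝ) :
    symPart (U * Y * Uᵀ) = U * symPart Y * Uᵀ := by
  simp [symPart, Matrix.mul_add, Matrix.add_mul, Matrix.mul_assoc]

lemma symPot_conj (hn : 1 ≤ n) {U : Matrix (Fin n) (Fin n) ℝ}
    (hU : U ∈ Matrix.orthogonalGroup (Fin n) ℝ) (Y : Matrix (Fin n) (Fin n) ℝ) :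
    symPot (U * Y * Uᵀ) = symPot Y := by
  rw [symPot, symPart_conj, avgPot_conj hn hU, symPot]

lemma continuous_expForm_coords (Y : Matrix (Fin n) (Fin n) ℝ) :
    Continuous fun u => expForm Y (coords (n := n) u) := by
  unfold expForm
  fun_prop

lemma integrable_of_continuous {f : UnitSphere n → ℝ} (hf : Continuous f) :
    Integrable f (uniformSphere n) :=
  hf.integrable_of_hasCompactSupport (HasCompactSupport.of_compactSpace _)

lemma continuous_randProj {Y : Matrix (Fin n) (Fin n) ℝ} (hY : Y.IsSymm) :
    Continuous fun u => randProj (coords (n := n) u) Y := by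
  unfold randProj
  have h := (continuous_expForm_coords Y).inv₀ fun u => (expForm_pos hY (coords_ne_zero u)).ne'
  have h2 : Continuous fun u => Matrix.vecMulVec (coords (n := n) u) (coords u) := by
    fun_prop
  exact h.smul (((continuous_const).mul h2).mul continuous_const)

lemma integrable_randProj {Y : Matrix (Fin n) (Fin n) ℝ} (hY : Y.IsSymm) (i j : Fin n) :
    Integrable (fun u => randProj (coords u) Y i j) (uniformSphere n) :=
  integrable_of_continuous ((continuous_randProj hY).matrix_elem i j)

lemma avgProj_conj (hn : 1 ≤ n) {U : Matrix (Fin n) (Fin n) ℝ}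
    (hU : U ∈ Matrix.orthogonalGroup (Fin n) ℝ) {Y : Matrix (Fin n) (Fin n) ℝ} (hY : Y.IsSymm) :
    avgProj (U * Y * Uᵀ) = U * avgProj Y * Uᵀ := by
  ext i j
  have h := integral_comp_mulVec hn (transpose_mem_orthogonalGroup hU)
    fun v => (U * randProj v Y * Uᵀ) i j
  simp only [avgProj, Matrix.of_apply, randProj_conj hU]
  rw [h]
  simp only [Matrix.mul_apply, Matrix.of_apply]
  have hint := integrable_randProj hY
  rw [integral_finsetSum _ fun k _ => Integrable.mul_const
    (integrable_finsetSum _ fun l _ => (hint _ _).const_mul _) _]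
  refine Finset.sum_congr rfl fun k _ => ?_
  rw [integral_mul_const, integral_finsetSum _ fun l _ => (hint _ _).const_mul _]
  simp only [integral_const_mul]

/-! ### Diagonal matrices and softmax weights. -/

/-- The softmax weights `e^{λᵢ} vᵢ² / ∑ₖ e^{λₖ} vₖ²`. -/
def softWeight (l v : Fin n → ℝ) (i : Fin n) : ℝ :=
  Real.exp (l i) * v i ^ 2 / ∑ k, Real.exp (l k) * v k ^ 2

/-- The averaged softmax weights: the eigenvalues of `P̄ (diag λ)`. -/
def avgWeight (l : Fin n → ℝ) (i : Fin n) : ℝ :=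
  ∫ u, softWeight l (coords u) i ∂(uniformSphere n)

lemma exp_diagonal_real (l : Fin n → ℝ) :
    NormedSpace.exp (Matrix.diagonal l) = Matrix.diagonal fun i => Real.exp (l i) := by
  rw [Matrix.exp_diagonal]
  congr 1
  ext i
  rw [Real.exp_eq_exp_ℝ, Pi.coe_exp]

lemma expForm_diagonal (l v : Fin n → ℝ) :
    expForm (Matrix.diagonal l) v = ∑ k, Real.exp (l k) * v k ^ 2 := by
  rw [expForm, exp_diagonal_real, dotProduct]
  simp only [Matrix.mulVec_diagonal]
  exact Finset.sum_congr rfl fun k _ => by ring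

lemma randProj_diagonal (l v : Fin n → ℝ) (i j : Fin n) :
    randProj v (Matrix.diagonal l) i j =
      Real.exp (l i / 2) * v i * (v j * Real.exp (l j / 2)) /
        ∑ k, Real.exp (l k) * v k ^ 2 := by
  have : (1 / 2 : ℝ) • Matrix.diagonal l = Matrix.diagonal fun i => l i / 2 := by
    ext a b
    by_cases h : a = b <;> simp [h]; ring
  rw [randProj, expForm_diagonal, this, exp_diagonal_real]
  simp [Matrix.mul_diagonal, Matrix.diagonal_mul, Matrix.vecMulVec_apply]
  ring

/-- The reflection in the `k`-th coordinate. -/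
def signFlip (k : Fin n) : Matrix (Fin n) (Fin n) ℝ :=
  Matrix.diagonal fun i => if i = k then -1 else 1

lemma transpose_signFlip (k : Fin n) : (signFlip k)ᵀ = signFlip k := by simp [signFlip]

lemma signFlip_mem (k : Fin n) : signFlip k ∈ Matrix.orthogonalGroup (Fin n) ℝ := by
  rw [Matrix.mem_orthogonalGroup_iff]
  rw [transpose_signFlip, signFlip, Matrix.diagonal_mul_diagonal, ← Matrix.diagonal_one]
  congr 1
  ext i
  split_ifs <;> simp

lemma signFlip_conj (k : Fin n) (A : Matrix (Fin n) (Fin n) ℝ) (i j : Fin n) :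
    (signFlip k * A * (signFlip k)ᵀ) i j =
      (if i = k then -1 else 1) * A i j * (if j = k then -1 else 1) := by
  rw [transpose_signFlip, signFlip, Matrix.mul_diagonal, Matrix.diagonal_mul]

/-- Reflecting coordinate `i` fixes `diag l` and the law of `u` but negates the entries `(i, j)`, `j
≠ i`, so these vanish. -/
lemma avgProj_diagonal (hn : 1 ≤ n) (l : Fin n → ℝ) :
    avgProj (Matrix.diagonal l) = Matrix.diagonal (avgWeight l) := by
  ext i j
  by_cases h : i = j
  · subst h
    rw [Matrix.diagonal_apply_eq, avgProj, Matrix.of_apply, avgWeight]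
    congr 1
    ext u
    rw [randProj_diagonal, softWeight]
    congr 1
    have : Real.exp (l i) = Real.exp (l i / 2) * Real.exp (l i / 2) := by
      rw [← Real.exp_add]; ring_nf
    rw [this]; ring
  · rw [Matrix.diagonal_apply_ne _ h]
    have h1 := avgProj_conj hn (signFlip_mem i) (Y := Matrix.diagonal l) (Matrix.isSymm_diagonal l)
    have h2 : signFlip i * Matrix.diagonal l * (signFlip i)ᵀ = Matrix.diagonal l := by
      ext a b
      rw [signFlip_conj]
      by_cases hab : a = b
      · subst hab; split_ifs <;> simp
      · simp [hab]
    rw [h2] at h1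
    have h3 := congrFun (congrFun h1 i) j
    rw [signFlip_conj, if_pos rfl, if_neg (Ne.symm h)] at h3
    linarith

lemma sum_exp_mul_sq_pos (l : Fin n → ℝ) {v : Fin n → ℝ} (hv : v ≠ 0) :
    0 < ∑ k, Real.exp (l k) * v k ^ 2 := by
  rw [← expForm_diagonal]
  exact expForm_pos (Matrix.isSymm_diagonal l) hv

lemma continuous_softWeight (l : Fin n → ℝ) (i : Fin n) :
    Continuous fun u => softWeight l (coords (n := n) u) i := by
  unfold softWeight
  have h1 : Continuous fun u => coords (n := n) u := continuous_coords
  refine Continuous.div (by fun_prop) (by fun_prop) fun u =>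
    (sum_exp_mul_sq_pos l (coords_ne_zero u)).ne'

lemma integrable_softWeight (l : Fin n → ℝ) (i : Fin n) :
    Integrable (fun u => softWeight l (coords u) i) (uniformSphere n) :=
  integrable_of_continuous (continuous_softWeight l i)

lemma softWeight_nonneg (l v : Fin n → ℝ) (i : Fin n) : 0 ≤ softWeight l v i := by
  unfold softWeight
  positivity

lemma sum_softWeight (l : Fin n → ℝ) {v : Fin n → ℝ} (hv : v ≠ 0) :
    ∑ i, softWeight l v i = 1 := by
  unfold softWeight
  rw [← Finset.sum_div, div_self (sum_exp_mul_sq_pos l hv).ne']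

lemma avgWeight_nonneg (l : Fin n → ℝ) (i : Fin n) : 0 ≤ avgWeight l i :=
  integral_nonneg fun _ => softWeight_nonneg _ _ _

lemma sum_avgWeight (hn : 1 ≤ n) (l : Fin n → ℝ) : ∑ i, avgWeight l i = 1 := by
  have := isProbabilityMeasure_uniformSphere hn
  unfold avgWeight
  rw [← integral_finsetSum _ fun i _ => integrable_softWeight l i]
  simp [sum_softWeight l (coords_ne_zero _)]

/-- Adding `d` to `λ` reweights the form: `∑ e^{λ+d} v² = (∑ e^λ v²) (∑ s e^d)`. -/
lemma sum_exp_add (l d : Fin n → ℝ) {v : Fin n → ℝ} (hv : v ≠ 0) :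
    ∑ k, Real.exp (l k + d k) * v k ^ 2 =
      (∑ k, Real.exp (l k) * v k ^ 2) * ∑ k, softWeight l v k * Real.exp (d k) := by
  have := (sum_exp_mul_sq_pos l hv).ne'
  rw [Finset.mul_sum]
  refine Finset.sum_congr rfl fun k _ => ?_
  rw [softWeight, Real.exp_add]
  field_simp

lemma sum_softWeight_mul_exp_pos (l d : Fin n → ℝ) {v : Fin n → ℝ} (hv : v ≠ 0) :
    0 < ∑ k, softWeight l v k * Real.exp (d k) := by
  have h1 := sum_exp_mul_sq_pos l hv
  have h2 := sum_exp_mul_sq_pos (fun k => l k + d k) hv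
  rw [sum_exp_add l d hv] at h2
  exact (mul_pos_iff_of_pos_left h1).1 h2

lemma integrable_log_expForm {Y : Matrix (Fin n) (Fin n) ℝ} (hY : Y.IsSymm) :
    Integrable (fun u => Real.log (expForm Y (coords u))) (uniformSphere n) :=
  integrable_of_continuous ((continuous_expForm_coords Y).log
    fun u => (expForm_pos hY (coords_ne_zero u)).ne')

lemma integrable_sum_softWeight_mul (l d : Fin n → ℝ) :
    Integrable (fun u => ∑ k, softWeight l (coords u) k * d k) (uniformSphere n) :=
  integrable_finsetSum _ fun k _ => (integrable_softWeight l k).mul_const _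

lemma integral_sum_softWeight_mul (l d : Fin n → ℝ) :
    ∫ u, ∑ k, softWeight l (coords u) k * d k ∂(uniformSphere n) = ∑ k, avgWeight l k * d k := by
  rw [integral_finsetSum _ fun k _ => (integrable_softWeight l k).mul_const _]
  simp only [integral_mul_const, avgWeight]

lemma avgPot_diagonal_sub (l d : Fin n → ℝ) :
    avgPot (Matrix.diagonal (l + d)) - avgPot (Matrix.diagonal l) =
      ∫ u, Real.log (∑ k, softWeight l (coords u) k * Real.exp (d k)) ∂(uniformSphere n) := by
  rw [avgPot, avgPot, ← integral_sub (integrable_log_expForm (Matrix.isSymm_diagonal _))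
    (integrable_log_expForm (Matrix.isSymm_diagonal _))]
  congr 1
  ext u
  have hu := coords_ne_zero u
  rw [expForm_diagonal, expForm_diagonal]
  simp only [Pi.add_apply]
  rw [sum_exp_add l d hu, Real.log_mul (sum_exp_mul_sq_pos l hu).ne'
    (sum_softWeight_mul_exp_pos l d hu).ne']
  ring

lemma integrable_log_sum_softWeight (l d : Fin n → ℝ) :
    Integrable (fun u => Real.log (∑ k, softWeight l (coords u) k * Real.exp (d k)))
      (uniformSphere n) := by
  refine integrable_of_continuous (Continuous.log ?_ fun u =>
    (sum_softWeight_mul_exp_pos l d (coords_ne_zero u)).ne')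
  exact continuous_finsetSum _ fun k _ => (continuous_softWeight l k).mul continuous_const

/-- Convexity of the potential along diagonal directions. -/
lemma sum_avgWeight_mul_le (l d : Fin n → ℝ) :
    ∑ k, avgWeight l k * d k ≤
      avgPot (Matrix.diagonal (l + d)) - avgPot (Matrix.diagonal l) := by
  rw [avgPot_diagonal_sub, ← integral_sum_softWeight_mul]
  refine integral_mono (integrable_sum_softWeight_mul l d) (integrable_log_sum_softWeight l d)
    fun u => ?_
  have hu := coords_ne_zero u
  rw [Real.le_log_iff_exp_le (sum_softWeight_mul_exp_pos l d hu)]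
  -- Jensen's inequality for the softmax weights.
  have := convexOn_exp.map_sum_le (t := Finset.univ) (w := softWeight l (coords u)) (p := d)
    (fun i _ => softWeight_nonneg _ _ _) (sum_softWeight l hu) (fun _ _ => trivial)
  simpa using this

/-- The symmetric second difference of the potential along diagonal directions. -/
lemma avgPot_diagonal_add_add_sub (hn : 1 ≤ n) (l d : Fin n → ℝ) :
    (avgPot (Matrix.diagonal (l + d)) - avgPot (Matrix.diagonal l)) +
      (avgPot (Matrix.diagonal (l + -d)) - avgPot (Matrix.diagonal l)) ≤
      2 * ∑ k, avgWeight l k * (Real.cosh (d k) - 1) := by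
  have := isProbabilityMeasure_uniformSphere hn
  rw [avgPot_diagonal_sub, avgPot_diagonal_sub, ← integral_sum_softWeight_mul,
    ← integral_const_mul, ← integral_add (integrable_log_sum_softWeight _ _)
      (integrable_log_sum_softWeight _ _)]
  refine integral_mono ((integrable_log_sum_softWeight _ _).add
    (integrable_log_sum_softWeight _ _)) ((integrable_sum_softWeight_mul _ _).const_mul _)
    fun u => ?_
  have hu := coords_ne_zero u
  have hx := sum_softWeight_mul_exp_pos l d hu
  have hy := sum_softWeight_mul_exp_pos l (-d) hu
  -- Applying `log x ≤ x - 1` to both factors leaves a sum of `cosh`, already of second order in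
  -- `d`.
  have h1 := Real.log_le_sub_one_of_pos hx
  have h2 := Real.log_le_sub_one_of_pos hy
  have h3 : ∑ k, softWeight l (coords u) k * (Real.cosh (d k) - 1) =
      ((∑ k, softWeight l (coords u) k * Real.exp (d k)) +
        ∑ k, softWeight l (coords u) k * Real.exp ((-d) k)) / 2 - 1 := by
    nth_rw 2 [← sum_softWeight l hu]
    rw [← Finset.sum_add_distrib, Finset.sum_div, ← Finset.sum_sub_distrib]
    refine Finset.sum_congr rfl fun k _ => ?_
    rw [Real.cosh_eq, Pi.neg_apply]; ring
  simp only [h3]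
  linarith

/-! ### First and second differentials, as algebraic maps whose later use mentions no matrix norm.
-/

section Differential

variable {E : Type} [NormedAddCommGroup E] [NormedSpace ℝ E]

/-- The differential, as a plain linear map. -/
def linDiff (f : E → ℝ) (Y : E) : E →ₗ[ℝ] ℝ := (fderiv ℝ f Y).toLinearMap

/-- The second differential, as a plain bilinear map. -/
def bilinDiff (f : E → ℝ) (Y : E) : E →ₗ[ℝ] E →ₗ[ℝ] ℝ :=
  (ContinuousLinearMap.coeLM ℝ).comp (fderiv ℝ (fderiv ℝ f) Y).toLinearMap

lemma hasDerivAt_add_smul (Y D : E) (t : ℝ) : HasDerivAt (fun t : ℝ => Y + t • D) D t := by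
  simpa using ((hasDerivAt_id t).smul_const D).const_add Y

lemma hasDerivAt_line {f : E → ℝ} (hf : ContDiff ℝ 2 f) (Y D : E) (t : ℝ) :
    HasDerivAt (fun t : ℝ => f (Y + t • D)) (linDiff f (Y + t • D) D) t := by
  have h1 : HasFDerivAt f (fderiv ℝ f (Y + t • D)) (Y + t • D) :=
    (hf.differentiable (by simp) _).hasFDerivAt
  exact h1.comp_hasDerivAt t (hasDerivAt_add_smul Y D t)

lemma hasDerivAt_linDiff_line {f : E → ℝ} (hf : ContDiff ℝ 2 f) (Y D B : E) (t : ℝ) :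
    HasDerivAt (fun t : ℝ => linDiff f (Y + t • D) B) (bilinDiff f (Y + t • D) D B) t := by
  have h0 : ContDiff ℝ 1 (fderiv ℝ f) := hf.fderiv_right (by norm_num)
  have h1 : HasFDerivAt (fderiv ℝ f) (fderiv ℝ (fderiv ℝ f) (Y + t • D)) (Y + t • D) :=
    (h0.differentiable (by simp) _).hasFDerivAt
  have h3 := h1.comp_hasDerivAt t (hasDerivAt_add_smul Y D t)
  have h4 := h3.clm_apply (hasDerivAt_const t B)
  simpa [linDiff, bilinDiff] using h4

lemma continuous_linDiff {f : E → ℝ} (hf : ContDiff ℝ 2 f) (B : E) :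
    Continuous fun Y => linDiff f Y B :=
  (hf.continuous_fderiv (by simp)).clm_apply continuous_const

lemma continuous_bilinDiff {f : E → ℝ} (hf : ContDiff ℝ 2 f) (D B : E) :
    Continuous fun Y => bilinDiff f Y D B := by
  have h0 : ContDiff ℝ 1 (fderiv ℝ f) := hf.fderiv_right (by norm_num)
  exact ((h0.continuous_fderiv (by simp)).clm_apply continuous_const).clm_apply continuous_const

end Differential

section Norm

open scoped Matrix.Norms.Operator

/-- The differential of the potential. -/
def dPot (Y : Matrix (Fin n) (Fin n) ℝ) : Matrix (Fin n) (Fin n) ℝ →ₗ[ℝ] ℝ :=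
  linDiff symPot Y

/-- The second differential of the potential. -/
def hessPot (Y : Matrix (Fin n) (Fin n) ℝ) :
    Matrix (Fin n) (Fin n) ℝ →ₗ[ℝ] Matrix (Fin n) (Fin n) ℝ →ₗ[ℝ] ℝ :=
  bilinDiff symPot Y

lemma hasDerivAt_symPot_line (Y D : Matrix (Fin n) (Fin n) ℝ) (t : ℝ) :
    HasDerivAt (fun t : ℝ => symPot (Y + t • D)) (dPot (Y + t • D) D) t :=
  hasDerivAt_line (contDiff_symPot 2) Y D t

lemma hasDerivAt_dPot_line (Y D B : Matrix (Fin n) (Fin n) ℝ) (t : ℝ) :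
    HasDerivAt (fun t : ℝ => dPot (Y + t • D) B) (hessPot (Y + t • D) D B) t :=
  hasDerivAt_linDiff_line (contDiff_symPot 2) Y D B t

lemma continuous_symPot : Continuous (symPot (n := n)) := (contDiff_symPot 0).continuous

lemma continuous_dPot (B : Matrix (Fin n) (Fin n) ℝ) : Continuous fun Y => dPot Y B :=
  continuous_linDiff (contDiff_symPot 2) B

lemma continuous_hessPot (D B : Matrix (Fin n) (Fin n) ℝ) : Continuous fun Y => hessPot Y D B :=
  continuous_bilinDiff (contDiff_symPot 2) D B

end Norm

/-! ### The gradient of the potential. -/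

lemma dPot_conj (hn : 1 ≤ n) {U : Matrix (Fin n) (Fin n) ℝ}
    (hU : U ∈ Matrix.orthogonalGroup (Fin n) ℝ) (Y B : Matrix (Fin n) (Fin n) ℝ) :
    dPot (U * Y * Uᵀ) (U * B * Uᵀ) = dPot Y B := by
  have h1 := hasDerivAt_symPot_line (U * Y * Uᵀ) (U * B * Uᵀ) 0
  have h2 := hasDerivAt_symPot_line Y B 0
  have h3 : (fun t : ℝ => symPot (U * Y * Uᵀ + t • (U * B * Uᵀ))) =
      fun t => symPot (Y + t • B) := by
    ext t
    rw [← symPot_conj hn hU (Y + t • B)]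
    simp [Matrix.mul_add, Matrix.add_mul]
  rw [h3] at h1
  simpa using h1.unique h2

lemma hessPot_conj (hn : 1 ≤ n) {U : Matrix (Fin n) (Fin n) ℝ}
    (hU : U ∈ Matrix.orthogonalGroup (Fin n) ℝ) (Y D B : Matrix (Fin n) (Fin n) ℝ) :
    hessPot (U * Y * Uᵀ) (U * D * Uᵀ) (U * B * Uᵀ) = hessPot Y D B := by
  have h1 := hasDerivAt_dPot_line (U * Y * Uᵀ) (U * D * Uᵀ) (U * B * Uᵀ) 0
  have h2 := hasDerivAt_dPot_line Y D B 0
  have h3 : (fun t : ℝ => dPot (U * Y * Uᵀ + t • (U * D * Uᵀ)) (U * B * Uᵀ)) =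
      fun t => dPot (Y + t • D) B := by
    ext t
    rw [← dPot_conj hn hU (Y + t • D)]
    simp [Matrix.mul_add, Matrix.add_mul]
  rw [h3] at h1
  simpa using h1.unique h2

lemma linearMap_apply_eq_sum (L : Matrix (Fin n) (Fin n) ℝ →ₗ[ℝ] ℝ) (B : Matrix (Fin n) (Fin n) ℝ) :
    L B = ∑ i, ∑ j, B i j * L (Matrix.single i j 1) := by
  conv_lhs => rw [Matrix.matrix_eq_sum_single B]
  simp only [map_sum]
  refine Finset.sum_congr rfl fun i _ => Finset.sum_congr rfl fun j _ => ?_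
  rw [← smul_eq_mul, ← map_smul, Matrix.smul_single, smul_eq_mul, mul_one]

lemma signFlip_conj_diagonal (k : Fin n) (l : Fin n → ℝ) :
    signFlip k * Matrix.diagonal l * (signFlip k)ᵀ = Matrix.diagonal l := by
  ext a b
  rw [signFlip_conj]
  by_cases hab : a = b
  · subst hab; split_ifs <;> simp
  · simp [hab]

lemma signFlip_conj_single {k m : Fin n} (h : k ≠ m) :
    signFlip k * Matrix.single k m (1 : ℝ) * (signFlip k)ᵀ = -Matrix.single k m 1 := by
  ext a b
  rw [signFlip_conj, Matrix.neg_apply, Matrix.single_apply]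
  by_cases ha : k = a
  · by_cases hb : m = b
    · subst ha hb; simp [h.symm]
    · simp [hb]
  · simp [ha]

/-- The reflection in coordinate `k` fixes the base point and negates the matrix unit, so the value
equals its own negative. -/
lemma dPot_diagonal_single_ne (hn : 1 ≤ n) (l : Fin n → ℝ) {k m : Fin n} (h : k ≠ m) :
    dPot (Matrix.diagonal l) (Matrix.single k m 1) = 0 := by
  have := dPot_conj hn (signFlip_mem k) (Matrix.diagonal l) (Matrix.single k m 1)
  rw [signFlip_conj_diagonal, signFlip_conj_single h, map_neg] at this
  linarith

/-- The same reflection shows that the Hessian at a diagonal matrix does not couple diagonal and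
off-diagonal directions. -/
lemma hessPot_diagonal_single_ne (hn : 1 ≤ n) (l d : Fin n → ℝ) {k m : Fin n} (h : k ≠ m) :
    hessPot (Matrix.diagonal l) (Matrix.single k m 1) (Matrix.diagonal d) = 0 := by
  have := hessPot_conj hn (signFlip_mem k) (Matrix.diagonal l) (Matrix.single k m 1)
    (Matrix.diagonal d)
  rw [signFlip_conj_diagonal, signFlip_conj_diagonal, signFlip_conj_single h, map_neg,
    LinearMap.neg_apply] at this
  linarith

lemma linearMap_apply_eq_diagonal (L : Matrix (Fin n) (Fin n) ℝ →ₗ[ℝ] ℝ)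
    (hL : ∀ i j, i ≠ j → L (Matrix.single i j 1) = 0) (B : Matrix (Fin n) (Fin n) ℝ) :
    L B = L (Matrix.diagonal fun i => B i i) := by
  rw [linearMap_apply_eq_sum L B, linearMap_apply_eq_sum L (Matrix.diagonal _)]
  refine Finset.sum_congr rfl fun i _ => Finset.sum_congr rfl fun j _ => ?_
  by_cases h : i = j
  · subst h; simp
  · simp [hL i j h]

lemma diagonal_add_smul (l d : Fin n → ℝ) (t : ℝ) :
    Matrix.diagonal l + t • Matrix.diagonal d = Matrix.diagonal (l + t • d) := by
  rw [← Matrix.diagonal_smul, Matrix.diagonal_add]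
  rfl

/-- Convexity replaces differentiation under the integral: by `sum_avgWeight_mul_le` the potential
minus its candidate tangent has a minimum at `t = 0`, so its derivative there is zero. -/
lemma dPot_diagonal_diagonal (l d : Fin n → ℝ) :
    dPot (Matrix.diagonal l) (Matrix.diagonal d) = ∑ k, avgWeight l k * d k := by
  have h1 := hasDerivAt_symPot_line (Matrix.diagonal l) (Matrix.diagonal d) 0
  have h2 := h1.sub ((hasDerivAt_id (0 : ℝ)).mul_const (∑ k, avgWeight l k * d k))
  have h3 : IsLocalMin ((fun t : ℝ => symPot (Matrix.diagonal l + t • Matrix.diagonal d)) -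
      fun t : ℝ => id t * ∑ k, avgWeight l k * d k) 0 := by
    refine Filter.Eventually.of_forall fun t => ?_
    have h := sum_avgWeight_mul_le l (t • d)
    simp only [Pi.sub_apply, id, zero_smul, add_zero, zero_mul, sub_zero, diagonal_add_smul,
      symPot_eq (Matrix.isSymm_diagonal _)]
    have : ∑ k, avgWeight l k * (t • d) k = t * ∑ k, avgWeight l k * d k := by
      rw [Finset.mul_sum]
      exact Finset.sum_congr rfl fun k _ => by simp only [Pi.smul_apply, smul_eq_mul]; ring
    linarith
  have h4 := h3.hasDerivAt_eq_zero h2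
  simp only [zero_smul, add_zero, one_mul] at h4
  linarith

lemma dPot_diagonal (hn : 1 ≤ n) (l : Fin n → ℝ) (B : Matrix (Fin n) (Fin n) ℝ) :
    dPot (Matrix.diagonal l) B = ∑ k, avgWeight l k * B k k := by
  rw [linearMap_apply_eq_diagonal _ (fun i j => dPot_diagonal_single_ne hn l),
    dPot_diagonal_diagonal]

lemma exists_orthogonal_diagonal {Y : Matrix (Fin n) (Fin n) ℝ} (hY : Y.IsSymm) :
    ∃ U ∈ Matrix.orthogonalGroup (Fin n) ℝ, ∃ l : Fin n → ℝ, Y = U * Matrix.diagonal l * Uᵀ := by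
  have hH : Y.IsHermitian := by
    rw [Matrix.IsHermitian, Matrix.conjTranspose_eq_transpose_of_trivial, hY.eq]
  refine ⟨hH.eigenvectorUnitary, hH.eigenvectorUnitary.2, hH.eigenvalues, ?_⟩
  have := hH.spectral_theorem
  rw [Unitary.conjStarAlgAut_apply, Matrix.star_eq_conjTranspose,
    Matrix.conjTranspose_eq_transpose_of_trivial] at this
  exact this

lemma avgProj_orthogonal_diagonal (hn : 1 ≤ n) {U : Matrix (Fin n) (Fin n) ℝ}
    (hU : U ∈ Matrix.orthogonalGroup (Fin n) ℝ) (l : Fin n → ℝ) :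
    avgProj (U * Matrix.diagonal l * Uᵀ) = U * Matrix.diagonal (avgWeight l) * Uᵀ := by
  rw [avgProj_conj hn hU (Matrix.isSymm_diagonal l), avgProj_diagonal hn]

lemma isSymm_avgProj (hn : 1 ≤ n) {Y : Matrix (Fin n) (Fin n) ℝ} (hY : Y.IsSymm) :
    (avgProj Y).IsSymm := by
  obtain ⟨U, hU, l, rfl⟩ := exists_orthogonal_diagonal hY
  rw [avgProj_orthogonal_diagonal hn hU]
  simp [Matrix.IsSymm, Matrix.mul_assoc]

/-- The gradient of the potential is the average mirror projection. -/
theorem dPot_eq_trace (hn : 1 ≤ n) {Y : Matrix (Fin n) (Fin n) ℝ} (hY : Y.IsSymm)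
    (B : Matrix (Fin n) (Fin n) ℝ) : dPot Y B = (B * avgProj Y).trace := by
  obtain ⟨U, hU, l, rfl⟩ := exists_orthogonal_diagonal hY
  have hB : B = U * (Uᵀ * B * U) * Uᵀ := by
    have h := orthogonal_mul_transpose hU
    calc B = (U * Uᵀ) * B * (U * Uᵀ) := by rw [h]; simp
      _ = _ := by simp only [Matrix.mul_assoc]
  have h1 : dPot (U * Matrix.diagonal l * Uᵀ) B =
      dPot (Matrix.diagonal l) (Uᵀ * B * U) := by
    conv_lhs => rw [hB]
    rw [dPot_conj hn hU]
  rw [h1, dPot_diagonal hn, avgProj_orthogonal_diagonal hn hU, ← Matrix.mul_assoc,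
    Matrix.trace_mul_comm, ← Matrix.mul_assoc, ← Matrix.mul_assoc, Matrix.trace]
  refine Finset.sum_congr rfl fun k _ => ?_
  rw [Matrix.diag_apply, Matrix.mul_diagonal, mul_comm]

lemma dPot_eq_frobInner (hn : 1 ≤ n) {Y : Matrix (Fin n) (Fin n) ℝ} (hY : Y.IsSymm)
    {B : Matrix (Fin n) (Fin n) ℝ} (hB : B.IsSymm) : dPot Y B = frobInner B (avgProj Y) := by
  rw [dPot_eq_trace hn hY, frobInner, hB.eq]

/-- Makes the entries of `P̄` differentiable along symmetric lines, with derivatives given by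
`hessPot`. -/
lemma avgProj_apply_eq_dPot (hn : 1 ≤ n) {Y : Matrix (Fin n) (Fin n) ℝ} (hY : Y.IsSymm)
    (i j : Fin n) : avgProj Y i j = dPot Y (Matrix.single i j 1) := by
  rw [dPot_eq_trace hn hY, Matrix.trace_single_mul, one_smul, (isSymm_avgProj hn hY).apply]

/-- One orthogonal matrix diagonalizes both factors. This identity is differentiated below to reach
the off-diagonal Hessian. -/
lemma commute_avgProj (hn : 1 ≤ n) {Y : Matrix (Fin n) (Fin n) ℝ} (hY : Y.IsSymm) :
    avgProj Y * Y = Y * avgProj Y := by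
  obtain ⟨U, hU, l, rfl⟩ := exists_orthogonal_diagonal hY
  rw [avgProj_orthogonal_diagonal hn hU]
  have h := orthogonal_transpose_mul hU
  have key : ∀ a b : Fin n → ℝ, U * Matrix.diagonal a * Uᵀ * (U * Matrix.diagonal b * Uᵀ) =
      U * Matrix.diagonal (a * b) * Uᵀ := fun a b => by
    calc _ = U * Matrix.diagonal a * (Uᵀ * U) * Matrix.diagonal b * Uᵀ := by
          simp only [Matrix.mul_assoc]
      _ = _ := by
          rw [h, Matrix.mul_one, Matrix.mul_assoc U, Matrix.diagonal_mul_diagonal]; rfl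
  rw [key, key, mul_comm]

/-! ### The Hessian bound. -/

/-- Differentiating `[Y, P̄(Y)] = 0` at a diagonal matrix. -/
lemma sub_mul_hessPot_single (hn : 1 ≤ n) (l : Fin n → ℝ) {D : Matrix (Fin n) (Fin n) ℝ}
    (hD : D.IsSymm) (i j : Fin n) :
    (l i - l j) * hessPot (Matrix.diagonal l) D (Matrix.single i j 1) =
      (avgWeight l i - avgWeight l j) * D i j := by
  set Y : ℝ → Matrix (Fin n) (Fin n) ℝ := fun t => Matrix.diagonal l + t • D with hYdef
  have hY0 : Y 0 = Matrix.diagonal l := by simp [hYdef]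
  have hYs : ∀ t, (Y t).IsSymm := fun t => (Matrix.isSymm_diagonal l).add (hD.smul t)
  have hP : ∀ a b, HasDerivAt (fun t => avgProj (Y t) a b)
      (hessPot (Matrix.diagonal l) D (Matrix.single a b 1)) 0 := by
    intro a b
    have := hasDerivAt_dPot_line (Matrix.diagonal l) D (Matrix.single a b 1) 0
    simp only [zero_smul, add_zero] at this
    convert this using 2 with t
    exact avgProj_apply_eq_dPot hn (hYs t) a b
  have hYd : ∀ a b, HasDerivAt (fun t => Y t a b) (D a b) 0 := by
    intro a b
    have := ((hasDerivAt_id (0 : ℝ)).mul_const (D a b)).const_add (Matrix.diagonal l a b)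
    simpa [hYdef] using this
  have h1 : HasDerivAt (fun t => (avgProj (Y t) * Y t) i j)
      (∑ k, (hessPot (Matrix.diagonal l) D (Matrix.single i k 1) * Y 0 k j +
        avgProj (Y 0) i k * D k j)) 0 := by
    simp only [Matrix.mul_apply]
    exact HasDerivAt.fun_sum fun k _ => (hP i k).mul (hYd k j)
  have h2 : HasDerivAt (fun t => (Y t * avgProj (Y t)) i j)
      (∑ k, (D i k * avgProj (Y 0) k j +
        Y 0 i k * hessPot (Matrix.diagonal l) D (Matrix.single k j 1))) 0 := by
    simp only [Matrix.mul_apply]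
    exact HasDerivAt.fun_sum fun k _ => (hYd i k).mul (hP k j)
  have h3 : (fun t => (avgProj (Y t) * Y t) i j) = fun t => (Y t * avgProj (Y t)) i j := by
    ext t; rw [commute_avgProj hn (hYs t)]
  rw [h3] at h1
  have h4 := h1.unique h2
  rw [hY0, avgProj_diagonal hn] at h4
  simp only [Finset.sum_add_distrib, Matrix.diagonal_apply, mul_ite, ite_mul, mul_zero, zero_mul,
    Finset.sum_ite_eq, Finset.sum_ite_eq', Finset.mem_univ, if_true] at h4
  linarith

/-- If `c > 0`, the second derivative test makes `0` a local minimum too; then `k` is constant near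
`0` and its second derivative vanishes. -/
lemma second_deriv_nonpos_of_max {k k' : ℝ → ℝ} {c : ℝ} (hk : ∀ t, HasDerivAt k (k' t) t)
    (hk' : HasDerivAt k' c 0) (hmax : ∀ t, k t ≤ k 0) : c ≤ 0 := by
  by_contra! hc
  have hd : deriv k = k' := funext fun t => (hk t).deriv
  have h0 : IsLocalMax k 0 := Filter.Eventually.of_forall hmax
  have h1 : IsLocalMin k 0 := isLocalMin_of_deriv_deriv_pos (by rw [hd, hk'.deriv]; exact hc)
    (h0.deriv_eq_zero) (hk 0).continuousAt
  have h2 : k =ᶠ[nhds 0] fun _ => k 0 := by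
    filter_upwards [h1] with t ht using le_antisymm (hmax t) ht
  have h3 : deriv k =ᶠ[nhds 0] fun _ => 0 := by
    have := h2.deriv
    simpa using this
  rw [hd] at h3
  have h4 := h3.deriv_eq
  rw [hk'.deriv] at h4
  simp at h4
  exact hc.ne' h4

/-- The bound on symmetric second differences is an equality at `t = 0`, so the second derivatives
in `t` of its two sides compare there. -/
lemma hessPot_diagonal_diagonal (hn : 1 ≤ n) (l d : Fin n → ℝ) :
    hessPot (Matrix.diagonal l) (Matrix.diagonal d) (Matrix.diagonal d) ≤
      ∑ k, avgWeight l k * d k ^ 2 := by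
  set L := Matrix.diagonal l
  set D := Matrix.diagonal d
  let k : ℝ → ℝ := fun t => symPot (L + t • D) + symPot (L + (-t) • D) -
    2 * ∑ k, avgWeight l k * (Real.cosh (t * d k) - 1)
  let k' : ℝ → ℝ := fun t => dPot (L + t • D) D - dPot (L + (-t) • D) D -
    2 * ∑ k, avgWeight l k * (Real.sinh (t * d k) * d k)
  have hk : ∀ t, HasDerivAt k (k' t) t := by
    intro t
    have h1 := hasDerivAt_symPot_line L D t
    have h2 := (hasDerivAt_symPot_line L D (-t)).scomp t (hasDerivAt_neg t)
    have h3 : HasDerivAt (fun t => ∑ k, avgWeight l k * (Real.cosh (t * d k) - 1))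
        (∑ k, avgWeight l k * (Real.sinh (t * d k) * d k)) t := by
      refine HasDerivAt.fun_sum fun i _ => HasDerivAt.const_mul _ (HasDerivAt.sub_const _ ?_)
      have := (Real.hasDerivAt_cosh (t * d i)).comp t ((hasDerivAt_id t).mul_const (d i))
      simpa [Function.comp_def] using this
    have h4 := (h1.add h2).sub (h3.const_mul 2)
    refine h4.congr_deriv ?_
    simp only [k', smul_eq_mul]
    ring
  have hk' : HasDerivAt k' (2 * hessPot L D D - 2 * ∑ k, avgWeight l k * d k ^ 2) 0 := by
    have h1 := hasDerivAt_dPot_line L D D 0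
    have h2' : HasDerivAt (fun t : ℝ => dPot (L + t • D) D) (hessPot L D D) (-0) := by
      have := hasDerivAt_dPot_line L D D (-0)
      simpa using this
    have h2 := h2'.scomp 0 (hasDerivAt_neg (0 : ℝ))
    have h3 : HasDerivAt (fun t => ∑ k, avgWeight l k * (Real.sinh (t * d k) * d k))
        (∑ k, avgWeight l k * (d k ^ 2)) 0 := by
      refine HasDerivAt.fun_sum fun i _ => HasDerivAt.const_mul _ ?_
      have := ((Real.hasDerivAt_sinh (0 * d i)).comp 0
        ((hasDerivAt_id (0 : ℝ)).mul_const (d i))).mul_const (d i)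
      simpa [Function.comp_def, sq] using this
    have h4 := (h1.sub h2).sub (h3.const_mul 2)
    refine h4.congr_deriv ?_
    simp only [zero_smul, add_zero, smul_eq_mul]
    ring
  have hmax : ∀ t, k t ≤ k 0 := by
    intro t
    have h := avgPot_diagonal_add_add_sub hn l (t • d)
    have e : -(t • d) = (-t) • d := by simp
    simp only [k, L, D, diagonal_add_smul, symPot_eq (Matrix.isSymm_diagonal _)]
    simp only [e, Pi.smul_apply, smul_eq_mul] at h
    simp only [zero_mul, neg_zero, zero_smul, add_zero, Real.cosh_zero, sub_self, mul_zero,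
      Finset.sum_const_zero]
    linarith
  linarith [second_deriv_nonpos_of_max hk hk' hmax]

/-- The symmetrization over the swap is essential: for `v` alone, `v j = 0 ≠ v i` would force `1 ≤ l
i - l j`. The swap exchanges the squares `x`, `y` of the two coordinates and leaves the rest `S` of
the denominator unchanged. -/
lemma softWeight_sub_add_swap_le (l : Fin n → ℝ) {i j : Fin n} (hij : i ≠ j) (h : l j ≤ l i)
    {v : Fin n → ℝ} (hv : v ≠ 0) :
    (softWeight l v i - softWeight l v j) +
        (softWeight l (v ∘ Equiv.swap i j) i - softWeight l (v ∘ Equiv.swap i j) j) ≤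
      (l i - l j) * ((softWeight l v i + softWeight l v j) +
        (softWeight l (v ∘ Equiv.swap i j) i + softWeight l (v ∘ Equiv.swap i j) j)) := by
  have hv' : v ∘ Equiv.swap i j ≠ 0 := by
    intro h0
    apply hv
    ext k
    have := congrFun h0 (Equiv.swap i j k)
    simpa using this
  have hN := sum_exp_mul_sq_pos l hv
  have hN' := sum_exp_mul_sq_pos l hv'
  have split : ∀ w : Fin n → ℝ, ∑ k, Real.exp (l k) * w k ^ 2 =
      Real.exp (l i) * w i ^ 2 + (Real.exp (l j) * w j ^ 2 +
        ∑ k ∈ (Finset.univ.erase i).erase j, Real.exp (l k) * w k ^ 2) := fun w => by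
    rw [Finset.add_sum_erase _ (fun k => Real.exp (l k) * w k ^ 2)
      (Finset.mem_erase.2 ⟨hij.symm, Finset.mem_univ j⟩),
      Finset.add_sum_erase _ (fun k => Real.exp (l k) * w k ^ 2) (Finset.mem_univ i)]
  have hS : ∑ k ∈ (Finset.univ.erase i).erase j, Real.exp (l k) * (v ∘ Equiv.swap i j) k ^ 2 =
      ∑ k ∈ (Finset.univ.erase i).erase j, Real.exp (l k) * v k ^ 2 := by
    refine Finset.sum_congr rfl fun k hk => ?_
    simp only [Finset.mem_erase] at hk
    rw [Function.comp_apply, Equiv.swap_apply_of_ne_of_ne hk.2.1 hk.1]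
  have hS0 : 0 ≤ ∑ k ∈ (Finset.univ.erase i).erase j, Real.exp (l k) * v k ^ 2 :=
    Finset.sum_nonneg fun k _ => by positivity
  simp only [softWeight]
  rw [split] at hN hN' ⊢
  rw [split (v ∘ Equiv.swap i j)]
  rw [hS] at hN' ⊢
  simp only [Function.comp_apply, Equiv.swap_apply_left, Equiv.swap_apply_right] at hN' ⊢
  -- This is `1 - δ ≤ e^{-δ}` multiplied by `e^{l i}`, with `δ = l i - l j`.
  have hab : Real.exp (l i) - Real.exp (l j) ≤ (l i - l j) * Real.exp (l i) := by
    have h1 := Real.add_one_le_exp (l j - l i)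
    have h2 : Real.exp (l j) = Real.exp (l i) * Real.exp (l j - l i) := by
      rw [← Real.exp_add]; ring_nf
    nlinarith [Real.exp_pos (l i)]
  have ha := Real.exp_pos (l i)
  have hb := Real.exp_pos (l j)
  generalize Real.exp (l i) = a at *
  generalize Real.exp (l j) = b at *
  generalize ∑ k ∈ (Finset.univ.erase i).erase j, Real.exp (l k) * v k ^ 2 = S at *
  have hd : 0 ≤ l i - l j := sub_nonneg.2 h
  generalize l i - l j = δ at *
  have hx := sq_nonneg (v i)
  have hy := sq_nonneg (v j)
  generalize v i ^ 2 = x at *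
  generalize v j ^ 2 = y at *
  rw [← sub_div, ← sub_div, ← add_div, ← add_div, div_add_div _ _ hN.ne' hN'.ne',
    div_add_div _ _ hN.ne' hN'.ne', ← mul_div_assoc]
  gcongr ?_ / _
  have hab' : a - b ≤ δ * (a + b) := by nlinarith
  -- After cross-multiplication, the right numerator minus the left one is exactly the sum of the
  -- three quantities in `e1`, `e2`, `e3`.
  have e1 : 0 ≤ (δ * (a + b) - (a - b)) * (S * (x + y)) :=
    mul_nonneg (sub_nonneg.2 hab') (by positivity)
  have e2 : 0 ≤ (δ * (a + b) - (a - b)) * (2 * (a + b) * (x * y)) :=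
    mul_nonneg (sub_nonneg.2 hab') (by positivity)
  have e3 : 0 ≤ δ * (2 * (a * b) * (x - y) ^ 2) := by positivity
  nlinarith [e1, e2, e3]

/-- The divided differences of the averaged softmax weights are bounded by their sum. -/
lemma avgWeight_sub_le (hn : 1 ≤ n) (l : Fin n → ℝ) {i j : Fin n} (h : l j ≤ l i) :
    avgWeight l i - avgWeight l j ≤ (l i - l j) * (avgWeight l i + avgWeight l j) := by
  rcases eq_or_ne i j with rfl | hij
  · simp
  set U : Matrix (Fin n) (Fin n) ℝ := (Equiv.swap i j).permMatrix ℝ with hUdef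
  have hU : U ∈ Matrix.orthogonalGroup (Fin n) ℝ := by
    rw [Matrix.mem_orthogonalGroup_iff, hUdef, Matrix.transpose_permMatrix,
      ← Matrix.permMatrix_mul, inv_mul_cancel, Matrix.permMatrix_one]
  have hUv : ∀ v : Fin n → ℝ, U *ᵥ v = v ∘ Equiv.swap i j := fun v => by
    rw [hUdef, Matrix.permMatrix_mulVec]
  -- Swapping two coordinates is orthogonal, so the swapped weights have the same averages and the
  -- symmetrized inequality integrates to twice the claim.
  have hswap : ∀ k, avgWeight l k =
      ∫ u, softWeight l (coords u ∘ Equiv.swap i j) k ∂(uniformSphere n) := by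
    intro k
    rw [avgWeight, ← integral_comp_mulVec hn hU fun v => softWeight l v k]
    simp only [hUv]
  have hne : ∀ u : UnitSphere n, coords u ∘ Equiv.swap i j ≠ 0 := by
    intro u h0
    apply coords_ne_zero u
    ext k
    have := congrFun h0 (Equiv.swap i j k)
    simpa using this
  have hint : ∀ k, Integrable (fun u => softWeight l (coords u ∘ Equiv.swap i j) k)
      (uniformSphere n) := by
    intro k
    refine integrable_of_continuous ?_
    unfold softWeight
    have h1 : Continuous fun u => coords (n := n) u := continuous_coords
    refine Continuous.div (by simp only [Function.comp_apply]; fun_prop)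
      (by simp only [Function.comp_apply]; fun_prop) fun u => (sum_exp_mul_sq_pos l (hne u)).ne'
  have hint' := integrable_softWeight l
  have a1 : Integrable (fun u => softWeight l (coords u) i - softWeight l (coords u) j)
      (uniformSphere n) := (hint' i).sub (hint' j)
  have a2 : Integrable (fun u => softWeight l (coords u ∘ Equiv.swap i j) i -
      softWeight l (coords u ∘ Equiv.swap i j) j) (uniformSphere n) := (hint i).sub (hint j)
  have b1 : Integrable (fun u => softWeight l (coords u) i + softWeight l (coords u) j)
      (uniformSphere n) := (hint' i).add (hint' j)
  have b2 : Integrable (fun u => softWeight l (coords u ∘ Equiv.swap i j) i +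
      softWeight l (coords u ∘ Equiv.swap i j) j) (uniformSphere n) := (hint i).add (hint j)
  have key := integral_mono (μ := uniformSphere n) (a1.add a2) ((b1.add b2).const_mul (l i - l j))
    fun u => softWeight_sub_add_swap_le l hij h (coords_ne_zero u)
  rw [integral_const_mul, integral_add' a1 a2, integral_add' b1 b2,
    integral_sub (hint' i) (hint' j), integral_sub (hint i) (hint j),
    integral_add (hint' i) (hint' j), integral_add (hint i) (hint j),
    ← hswap i, ← hswap j, ← avgWeight, ← avgWeight] at key
  linarith

/-- Diagonal entries contribute through `hessPot_diagonal_diagonal`. For the others, distinct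
eigenvalues allow division by `l i - l j` in the differentiated commutation identity. -/
lemma hessPot_diagonal_le_of_injective (hn : 1 ≤ n) {l : Fin n → ℝ} (hl : Function.Injective l)
    {D : Matrix (Fin n) (Fin n) ℝ} (hD : D.IsSymm) :
    hessPot (Matrix.diagonal l) D D ≤
      ∑ i, ∑ j, (avgWeight l i + avgWeight l j) * D i j ^ 2 := by
  set L := Matrix.diagonal l
  have hdiag : ∀ d, hessPot L D (Matrix.diagonal d) =
      hessPot L (Matrix.diagonal fun i => D i i) (Matrix.diagonal d) := fun d =>
    linearMap_apply_eq_diagonal ((hessPot L).flip (Matrix.diagonal d))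
      (fun i j hij => hessPot_diagonal_single_ne hn l d hij) D
  have hD2 : hessPot L D (Matrix.diagonal fun i => D i i) ≤ ∑ i, avgWeight l i * D i i ^ 2 := by
    rw [hdiag]
    exact hessPot_diagonal_diagonal hn l fun i => D i i
  have hoff : ∀ i j, i ≠ j → D i j * hessPot L D (Matrix.single i j 1) ≤
      (avgWeight l i + avgWeight l j) * D i j ^ 2 := by
    intro i j hij
    have h := sub_mul_hessPot_single hn l hD i j
    set H := hessPot (Matrix.diagonal l) D (Matrix.single i j 1) with hH
    rcases lt_or_gt_of_ne (hl.ne hij) with hlt | hlt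
    · have h1 := avgWeight_sub_le hn l hlt.le
      have h2 : (l j - l i) * (D i j * H) ≤
          (l j - l i) * ((avgWeight l i + avgWeight l j) * D i j ^ 2) := by
        have e : (l j - l i) * (D i j * H) = (avgWeight l j - avgWeight l i) * D i j ^ 2 := by
          linear_combination -(D i j) * h
        rw [e]
        nlinarith [sq_nonneg (D i j)]
      exact le_of_mul_le_mul_left h2 (sub_pos.2 hlt)
    · have h1 := avgWeight_sub_le hn l hlt.le
      have h2 : (l i - l j) * (D i j * H) ≤
          (l i - l j) * ((avgWeight l i + avgWeight l j) * D i j ^ 2) := by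
        have e : (l i - l j) * (D i j * H) = (avgWeight l i - avgWeight l j) * D i j ^ 2 := by
          linear_combination (D i j) * h
        rw [e]
        nlinarith [sq_nonneg (D i j)]
      exact le_of_mul_le_mul_left h2 (sub_pos.2 hlt)
  have hexp := linearMap_apply_eq_sum (hessPot L D) D
  have hexp2 := linearMap_apply_eq_sum (hessPot L D) (Matrix.diagonal fun i => D i i)
  have hsum2 : hessPot L D (Matrix.diagonal fun i => D i i) =
      ∑ i, D i i * hessPot L D (Matrix.single i i 1) := by
    rw [hexp2]
    refine Finset.sum_congr rfl fun i _ => ?_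
    rw [Finset.sum_eq_single i (fun j _ hj => by rw [Matrix.diagonal_apply_ne _ hj.symm, zero_mul])
      (by simp), Matrix.diagonal_apply_eq]
  have hsplit : ∀ F : Fin n → Fin n → ℝ, ∑ i, ∑ j, F i j =
      ∑ i, F i i + ∑ i, ∑ j ∈ Finset.univ.erase i, F i j := fun F => by
    rw [← Finset.sum_add_distrib]
    exact Finset.sum_congr rfl fun i _ => (Finset.add_sum_erase _ _ (Finset.mem_univ i)).symm
  rw [hexp, hsplit, ← hsum2, hsplit]
  refine add_le_add (hD2.trans (Finset.sum_le_sum fun i _ => ?_))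
    (Finset.sum_le_sum fun i _ => Finset.sum_le_sum fun j hj =>
      hoff i j (Finset.ne_of_mem_erase hj).symm)
  -- The diagonal part needs only half of the allowed `2 w i (D i i)²`.
  have := mul_nonneg (avgWeight_nonneg l i) (sq_nonneg (D i i))
  linarith

lemma avgWeight_eq_dPot (hn : 1 ≤ n) (l : Fin n → ℝ) (i : Fin n) :
    avgWeight l i = dPot (Matrix.diagonal l) (Matrix.single i i 1) := by
  rw [dPot_diagonal hn]
  simp [Matrix.single_apply]

/-- Equal entries separate for every `ε > 0`, since the added slopes differ; unequal entries stay
apart for small `ε`. -/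
lemma eventually_injective_add_smul (l : Fin n → ℝ) :
    ∀ᶠ ε in nhdsWithin (0 : ℝ) (Set.Ioi 0),
      Function.Injective (l + ε • fun i : Fin n => (i : ℝ)) := by
  have h : ∀ i j : Fin n, i ≠ j → ∀ᶠ ε in nhdsWithin (0 : ℝ) (Set.Ioi 0),
      l i + ε * i ≠ l j + ε * j := by
    intro i j hij
    have hij' : (i : ℝ) - j ≠ 0 := by
      rw [sub_ne_zero]
      exact_mod_cast fun h => hij (Fin.ext h)
    by_cases hl : l i = l j
    · filter_upwards [self_mem_nhdsWithin] with ε hε h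
      rw [hl] at h
      have : ε * ((i : ℝ) - j) = 0 := by linarith
      rcases mul_eq_zero.1 this with h0 | h0
      · exact (ne_of_gt hε) h0
      · exact hij' h0
    · have hc : Filter.Tendsto (fun ε : ℝ => (l i + ε * i) - (l j + ε * j)) (nhds 0)
          (nhds (l i - l j)) := by
        have : Continuous fun ε : ℝ => (l i + ε * i) - (l j + ε * j) := by fun_prop
        simpa using this.tendsto 0
      have := (hc.eventually_ne (sub_ne_zero.2 hl)).filter_mono
        (nhdsWithin_le_nhds (s := Set.Ioi 0))
      filter_upwards [this] with ε hε h
      exact hε (sub_eq_zero.2 h)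
  have h' : ∀ᶠ ε in nhdsWithin (0 : ℝ) (Set.Ioi 0), ∀ i j : Fin n, i ≠ j →
      l i + ε * i ≠ l j + ε * j := by
    simp only [Filter.eventually_all]
    exact h
  filter_upwards [h'] with ε hε i j hij
  by_contra hne
  exact hε i j hne (by simpa using hij)

/-- Both sides are continuous in the eigenvalues, so the case of distinct ones passes to the limit
`ε → 0⁺`. -/
lemma hessPot_diagonal_le (hn : 1 ≤ n) (l : Fin n → ℝ)
    {D : Matrix (Fin n) (Fin n) ℝ} (hD : D.IsSymm) :
    hessPot (Matrix.diagonal l) D D ≤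
      ∑ i, ∑ j, (avgWeight l i + avgWeight l j) * D i j ^ 2 := by
  have hc : Continuous fun ε : ℝ => Matrix.diagonal (l + ε • fun i : Fin n => (i : ℝ)) := by
    fun_prop
  have h1 : Continuous fun ε : ℝ =>
      hessPot (Matrix.diagonal (l + ε • fun i : Fin n => (i : ℝ))) D D :=
    (continuous_hessPot D D).comp hc
  have h2 : ∀ k, Continuous fun ε : ℝ => avgWeight (l + ε • fun i : Fin n => (i : ℝ)) k := by
    intro k
    simp only [avgWeight_eq_dPot hn]
    exact (continuous_dPot _).comp hc
  have h3 : Continuous fun ε : ℝ => ∑ i, ∑ j, (avgWeight (l + ε • fun i : Fin n => (i : ℝ)) i +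
      avgWeight (l + ε • fun i : Fin n => (i : ℝ)) j) * D i j ^ 2 := by
    fun_prop
  refine le_of_tendsto_of_tendsto ((h1.tendsto 0).mono_left (nhdsWithin_le_nhds (s := Set.Ioi 0)))
    ((h3.tendsto 0).mono_left (nhdsWithin_le_nhds (s := Set.Ioi 0))) ?_ |> fun h => by
      simpa using h
  filter_upwards [eventually_injective_add_smul l] with ε hε
  exact hessPot_diagonal_le_of_injective hn hε hD

/-- The Hessian of the potential is bounded by `2 ⟨P̄(Y), D²⟩`. -/
theorem hessPot_le (hn : 1 ≤ n) {Y D : Matrix (Fin n) (Fin n) ℝ} (hY : Y.IsSymm) (hD : D.IsSymm) :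
    hessPot Y D D ≤ 2 * dPot Y (D * D) := by
  obtain ⟨U, hU, l, rfl⟩ := exists_orthogonal_diagonal hY
  have h := orthogonal_mul_transpose hU
  have hB : ∀ B, B = U * (Uᵀ * B * U) * Uᵀ := fun B => by
    calc B = (U * Uᵀ) * B * (U * Uᵀ) := by rw [h]; simp
      _ = _ := by simp only [Matrix.mul_assoc]
  set C := Uᵀ * D * U with hC
  have hCs : C.IsSymm := by
    simp [hC, Matrix.IsSymm, Matrix.mul_assoc, hD.eq]
  have hDD : D * D = U * (C * C) * Uᵀ := by
    rw [hB (D * D), hC]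
    have : Uᵀ * (D * D) * U = Uᵀ * D * (U * Uᵀ) * D * U := by
      rw [h]; simp only [Matrix.mul_assoc, Matrix.one_mul]
    rw [this]
    simp only [Matrix.mul_assoc]
  rw [hDD, dPot_conj hn hU, hB D, hessPot_conj hn hU, dPot_diagonal hn]
  -- For symmetric `C` the double sum is `2 ∑ w i (C²) i i`, both halves being equal by exchanging
  -- indices.
  refine (hessPot_diagonal_le hn l hCs).trans (le_of_eq ?_)
  have e1 : ∀ k, (C * C) k k = ∑ j, C k j ^ 2 := fun k => by
    rw [Matrix.mul_apply]
    exact Finset.sum_congr rfl fun j _ => by rw [hCs.apply k j, sq]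
  have e2 : ∑ i, ∑ j, avgWeight l j * C i j ^ 2 = ∑ i, ∑ j, avgWeight l i * C i j ^ 2 := by
    rw [Finset.sum_comm]
    exact Finset.sum_congr rfl fun i _ => Finset.sum_congr rfl fun j _ => by
      rw [hCs.apply i j]
  simp only [add_mul, Finset.sum_add_distrib, e1, e2, Finset.mul_sum]
  rw [← Finset.sum_add_distrib]
  refine Finset.sum_congr rfl fun i _ => ?_
  rw [← Finset.sum_add_distrib]
  exact Finset.sum_congr rfl fun j _ => by ring

/-! ### From the Hessian bound to the two smoothness estimates. -/

/-- In an eigenbasis of `Y`, `dPot Y B` is a convex combination, with weights `avgWeight`, of the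
values of the form of `B` at the basis vectors. -/
lemma dPot_le (hn : 1 ≤ n) {Y : Matrix (Fin n) (Fin n) ℝ} (hY : Y.IsSymm)
    {B : Matrix (Fin n) (Fin n) ℝ} {c : ℝ}
    (h : ∀ v : Fin n → ℝ, v ⬝ᵥ v = 1 → v ⬝ᵥ (B *ᵥ v) ≤ c) : dPot Y B ≤ c := by
  obtain ⟨U, hU, l, rfl⟩ := exists_orthogonal_diagonal hY
  have hUU := orthogonal_mul_transpose hU
  have hB : B = U * (Uᵀ * B * U) * Uᵀ := by
    calc B = (U * Uᵀ) * B * (U * Uᵀ) := by rw [hUU]; simp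
      _ = _ := by simp only [Matrix.mul_assoc]
  rw [hB, dPot_conj hn hU, dPot_diagonal hn]
  have hk : ∀ k, (Uᵀ * B * U) k k ≤ c := by
    intro k
    have h1 : (Uᵀ * B * U) k k = (Uᵀ k) ⬝ᵥ (B *ᵥ (Uᵀ k)) := by
      rw [Matrix.dotProduct_mulVec]
      rfl
    rw [h1]
    refine h _ ?_
    have := congrFun (congrFun (orthogonal_transpose_mul hU) k) k
    rw [Matrix.one_apply_eq] at this
    rw [← this]
    rfl
  calc ∑ k, avgWeight l k * (Uᵀ * B * U) k k ≤ ∑ k, avgWeight l k * c :=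
        Finset.sum_le_sum fun k _ => mul_le_mul_of_nonneg_left (hk k) (avgWeight_nonneg l k)
    _ = c := by rw [← Finset.sum_mul, sum_avgWeight hn, one_mul]

lemma dPot_nonneg (hn : 1 ≤ n) {Y : Matrix (Fin n) (Fin n) ℝ} (hY : Y.IsSymm)
    {B : Matrix (Fin n) (Fin n) ℝ} (h : ∀ v : Fin n → ℝ, 0 ≤ v ⬝ᵥ (B *ᵥ v)) : 0 ≤ dPot Y B := by
  have := dPot_le hn hY (B := -B) (c := 0) fun v _ => by
    simpa [Matrix.neg_mulVec] using h v
  rw [map_neg] at this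
  linarith

lemma opNorm_nonneg (D : Matrix (Fin n) (Fin n) ℝ) : 0 ≤ opNorm D := norm_nonneg _

lemma norm_toLp_sq (v : Fin n → ℝ) : ‖WithLp.toLp 2 v‖ ^ 2 = v ⬝ᵥ v := by
  rw [EuclideanSpace.norm_sq_eq, dotProduct]
  exact Finset.sum_congr rfl fun i _ => by simp [sq]

lemma dotProduct_mulVec_self_le (D : Matrix (Fin n) (Fin n) ℝ) (v : Fin n → ℝ) :
    (D *ᵥ v) ⬝ᵥ (D *ᵥ v) ≤ opNorm D ^ 2 * (v ⬝ᵥ v) := by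
  rw [← norm_toLp_sq, ← norm_toLp_sq, ← mul_pow]
  have := (Matrix.toEuclideanCLM (n := Fin n) (𝕜 := ℝ) D).le_opNorm (WithLp.toLp 2 v)
  rw [Matrix.toEuclideanCLM_toLp] at this
  exact pow_le_pow_left₀ (norm_nonneg _) this 2

lemma dotProduct_mulVec_le (D : Matrix (Fin n) (Fin n) ℝ) (v : Fin n → ℝ) :
    v ⬝ᵥ (D *ᵥ v) ≤ opNorm D * (v ⬝ᵥ v) := by
  have h1 := (Matrix.toEuclideanCLM (n := Fin n) (𝕜 := ℝ) D).le_opNorm (WithLp.toLp 2 v)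
  rw [Matrix.toEuclideanCLM_toLp] at h1
  have h2 : v ⬝ᵥ (D *ᵥ v) ≤ ‖WithLp.toLp 2 v‖ * ‖WithLp.toLp 2 (D *ᵥ v)‖ := by
    have := real_inner_le_norm (WithLp.toLp 2 v) (WithLp.toLp 2 (D *ᵥ v))
    rwa [EuclideanSpace.inner_toLp_toLp, star_trivial, dotProduct_comm] at this
  rw [← norm_toLp_sq]
  calc _ ≤ _ := h2
    _ ≤ ‖WithLp.toLp 2 v‖ * (opNorm D * ‖WithLp.toLp 2 v‖) :=
        mul_le_mul_of_nonneg_left h1 (norm_nonneg _)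
    _ = _ := by ring

lemma dotProduct_mul_self_mulVec {D : Matrix (Fin n) (Fin n) ℝ} (hD : D.IsSymm) (v : Fin n → ℝ) :
    v ⬝ᵥ ((D * D) *ᵥ v) = (D *ᵥ v) ⬝ᵥ (D *ᵥ v) := by
  rw [← Matrix.mulVec_mulVec, Matrix.dotProduct_mulVec, ← Matrix.mulVec_transpose, hD.eq]

lemma posSemidef_dotProduct_nonneg {D : Matrix (Fin n) (Fin n) ℝ} (hD : D.PosSemidef)
    (v : Fin n → ℝ) : 0 ≤ v ⬝ᵥ (D *ᵥ v) := by
  simpa using hD.dotProduct_mulVec_nonneg v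

lemma isSymm_of_posSemidef {D : Matrix (Fin n) (Fin n) ℝ} (hD : D.PosSemidef) : D.IsSymm := by
  have := hD.isHermitian
  rwa [Matrix.IsHermitian, Matrix.conjTranspose_eq_transpose_of_trivial] at this

/-- For positive semidefinite `D`, `D² ≼ ‖D‖ D`. -/
lemma dotProduct_mulVec_self_le_of_posSemidef {D : Matrix (Fin n) (Fin n) ℝ} (hD : D.PosSemidef)
    (v : Fin n → ℝ) : (D *ᵥ v) ⬝ᵥ (D *ᵥ v) ≤ opNorm D * (v ⬝ᵥ (D *ᵥ v)) := by
  have hs := isSymm_of_posSemidef hD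
  set w := D *ᵥ v with hw
  set δ := opNorm D with hδ
  -- The test vector `δ v - w`, together with `⟨w, D w⟩ ≤ δ |w|²`, gives `δ |w|² ≤ δ² ⟨v, w⟩`
  -- without a square root of `D`; the case `δ = 0` is separate because `δ` is then cancelled.
  have h1 := posSemidef_dotProduct_nonneg hD (δ • v - w)
  have h2 := dotProduct_mulVec_le D w
  have h3 : v ⬝ᵥ (D *ᵥ w) = w ⬝ᵥ w := by
    rw [Matrix.dotProduct_mulVec, ← Matrix.mulVec_transpose, hs.eq]
  have h4 : (δ • v - w) ⬝ᵥ (D *ᵥ (δ • v - w)) =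
      δ ^ 2 * (v ⬝ᵥ w) - 2 * δ * (w ⬝ᵥ w) + w ⬝ᵥ (D *ᵥ w) := by
    simp only [Matrix.mulVec_sub, Matrix.mulVec_smul, sub_dotProduct, dotProduct_sub,
      smul_dotProduct, dotProduct_smul, smul_eq_mul, ← hw, h3]
    ring
  rw [h4] at h1
  rcases (opNorm_nonneg D).eq_or_lt with h0 | h0
  · have h5 := dotProduct_mulVec_self_le D v
    rw [← h0] at h5
    rw [hδ, ← h0]
    simpa using h5
  · have h6 : δ * (w ⬝ᵥ w) ≤ δ * (δ * (v ⬝ᵥ w)) := by nlinarith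
    exact le_of_mul_le_mul_left h6 h0

lemma isSymm_add_smul {Y D : Matrix (Fin n) (Fin n) ℝ} (hY : Y.IsSymm) (hD : D.IsSymm) (t : ℝ) :
    (Y + t • D).IsSymm := hY.add (hD.smul t)

lemma hessPot_le_sq (hn : 1 ≤ n) {Y D : Matrix (Fin n) (Fin n) ℝ} (hY : Y.IsSymm)
    (hD : D.IsSymm) : hessPot Y D D ≤ 2 * opNorm D ^ 2 := by
  refine (hessPot_le hn hY hD).trans ?_
  gcongr
  refine dPot_le hn hY fun v hv => ?_
  rw [dotProduct_mul_self_mulVec hD]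
  simpa [hv] using dotProduct_mulVec_self_le D v

lemma hessPot_le_of_posSemidef (hn : 1 ≤ n) {Y D : Matrix (Fin n) (Fin n) ℝ} (hY : Y.IsSymm)
    (hD : D.PosSemidef) : hessPot Y D D ≤ 2 * opNorm D * dPot Y D := by
  have hs := isSymm_of_posSemidef hD
  refine (hessPot_le hn hY hs).trans ?_
  have := dPot_nonneg hn hY (B := opNorm D • D - D * D) fun v => by
    rw [Matrix.sub_mulVec, dotProduct_sub, dotProduct_mul_self_mulVec hs, Matrix.smul_mulVec,
      dotProduct_smul, smul_eq_mul]
    linarith [dotProduct_mulVec_self_le_of_posSemidef hD v]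
  rw [map_sub, map_smul, smul_eq_mul] at this
  linarith

lemma le_of_hasDerivAt_nonpos {k k' : ℝ → ℝ} (hk : ∀ t, HasDerivAt k (k' t) t)
    (h : ∀ t, 0 ≤ t → t ≤ 1 → k' t ≤ 0) {t : ℝ} (h0 : 0 ≤ t) (h1 : t ≤ 1) : k t ≤ k 0 := by
  refine antitoneOn_of_deriv_nonpos (convex_Icc (0 : ℝ) 1)
    (fun t _ => (hk t).continuousAt.continuousWithinAt)
    (fun t _ => (hk t).differentiableAt.differentiableWithinAt) (fun t ht => ?_)
    (Set.left_mem_Icc.2 zero_le_one) ⟨h0, h1⟩ h0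
  rw [interior_Icc] at ht
  rw [(hk t).deriv]
  exact h t ht.1.le ht.2.le

/-- The function `g t - t g'(0) - c t²` is nonincreasing on `[0, 1]`. -/
lemma sub_sub_le_of_deriv_le {g g' : ℝ → ℝ} {c : ℝ} (hg : ∀ t, HasDerivAt g (g' t) t)
    (h : ∀ t, 0 ≤ t → t ≤ 1 → g' t ≤ g' 0 + 2 * c * t) : g 1 - g 0 - g' 0 ≤ c := by
  have hk : ∀ t, HasDerivAt (fun t => g t - t * g' 0 - c * t ^ 2)
      (g' t - 1 * g' 0 - c * (2 * t ^ 1 * 1)) t := fun t =>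
    ((hg t).sub ((hasDerivAt_id t).mul_const _)).sub (((hasDerivAt_id t).pow 2).const_mul c)
  have := le_of_hasDerivAt_nonpos hk (fun t h0 h1 => by linarith [h t h0 h1]) zero_le_one le_rfl
  simp only [one_mul, one_pow, mul_one, zero_mul, sub_zero] at this
  linarith

/-- The scalars `1 •` and `0 •` give the shape `g 1 - g 0 - g' 0` for the potential along the
segment. -/
lemma bregman_add_eq (hn : 1 ≤ n) {Y D : Matrix (Fin n) (Fin n) ℝ} (hY : Y.IsSymm)
    (hD : D.IsSymm) : bregman Y (Y + D) =
      symPot (Y + (1 : ℝ) • D) - symPot (Y + (0 : ℝ) • D) - dPot (Y + (0 : ℝ) • D) D := by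
  rw [bregman, one_smul, zero_smul, add_zero, add_sub_cancel_left, ← dPot_eq_frobInner hn hY hD,
    symPot_eq hY, symPot_eq (hY.add hD)]

/-- The second derivative along the segment is at most `2 ‖D‖²`, so the constant is 1. -/
theorem bregman_add_le (hn : 1 ≤ n) {Y D : Matrix (Fin n) (Fin n) ℝ} (hY : Y.IsSymm)
    (hD : D.IsSymm) : bregman Y (Y + D) ≤ opNorm D ^ 2 := by
  rw [bregman_add_eq hn hY hD]
  refine sub_sub_le_of_deriv_le (hasDerivAt_symPot_line Y D) fun t h0 h1 => ?_
  have hk : ∀ t, HasDerivAt (fun t : ℝ => dPot (Y + t • D) D - 2 * opNorm D ^ 2 * t)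
      (hessPot (Y + t • D) D D - 2 * opNorm D ^ 2 * 1) t := fun t =>
    (hasDerivAt_dPot_line Y D D t).sub ((hasDerivAt_id t).const_mul _)
  have := le_of_hasDerivAt_nonpos hk
    (fun t _ _ => by linarith [hessPot_le_sq hn (isSymm_add_smul hY hD t) hD]) h0 h1
  simp only [mul_zero, sub_zero] at this
  linarith

theorem bregman_add_le_of_posSemidef (hn : 1 ≤ n) {Y D : Matrix (Fin n) (Fin n) ℝ}
    (hY : Y.IsSymm) (hD : D.PosSemidef) (hDn : opNorm D ≤ 1 / 6) :
    bregman Y (Y + D) ≤ 3 * opNorm D * frobInner D (avgProj Y) := by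
  have hs := isSymm_of_posSemidef hD
  have hδ := opNorm_nonneg D
  rw [bregman_add_eq hn hY hs, ← dPot_eq_frobInner hn hY hs]
  refine sub_sub_le_of_deriv_le (hasDerivAt_symPot_line Y D) fun t h0 h1 => ?_
  -- Grönwall: since the Hessian is at most `2 ‖D‖ dPot`, the derivative damped by `e^{-2‖D‖t}` is
  -- nonincreasing.
  have hk : ∀ t, HasDerivAt (fun t : ℝ => Real.exp (-(2 * opNorm D) * t) * dPot (Y + t • D) D)
      (Real.exp (-(2 * opNorm D) * t) * (-(2 * opNorm D) * 1) * dPot (Y + t • D) D +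
        Real.exp (-(2 * opNorm D) * t) * hessPot (Y + t • D) D D) t := fun t =>
    (((hasDerivAt_id t).const_mul _).exp).mul (hasDerivAt_dPot_line Y D D t)
  have h2 := le_of_hasDerivAt_nonpos hk (fun t _ _ => by
    have := hessPot_le_of_posSemidef hn (isSymm_add_smul hY hs t) hD
    have he := Real.exp_pos (-(2 * opNorm D) * t)
    nlinarith) h0 h1
  simp only [mul_zero, Real.exp_zero, one_mul, zero_smul, add_zero] at h2 ⊢
  have hg0 : 0 ≤ dPot Y D := dPot_nonneg hn hY (posSemidef_dotProduct_nonneg hD)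
  set x := 2 * opNorm D * t with hx
  have hx0 : 0 ≤ x := by positivity
  have hx1 : x ≤ 1 / 3 := by nlinarith
  have h3 : dPot (Y + t • D) D ≤ Real.exp x * dPot Y D := by
    have e : -(2 * opNorm D) * t = -x := by rw [hx]; ring
    rw [e, Real.exp_neg, inv_mul_le_iff₀ (Real.exp_pos x)] at h2
    exact h2
  -- `(1 - x) e^x ≤ 1` gives `e^x ≤ 1 / (1 - x) ≤ 1 + 3 x`, where the last step holds for `0 ≤ x ≤
  -- 2/3`. The bound `‖D‖ ≤ 1/6` ensures `x ≤ 1/3`.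
  have h4 : Real.exp x ≤ 1 + 3 * x := by
    have h5 := Real.add_one_le_exp (-x)
    rw [Real.exp_neg] at h5
    have h6 : (1 - x) * Real.exp x ≤ 1 := by
      have := mul_le_mul_of_nonneg_right h5 (Real.exp_pos x).le
      rw [inv_mul_cancel₀ (Real.exp_pos x).ne'] at this
      linarith
    nlinarith [Real.exp_pos x]
  calc _ ≤ _ := h3
    _ ≤ (1 + 3 * x) * dPot Y D := mul_le_mul_of_nonneg_right h4 hg0
    _ = _ := by rw [hx]; ring

/-! ### Gaussian integrals and the lower bound on the potential. -/

/-- The integral is `Γ'(1/2)`, computed here by uniqueness of the complex derivative. The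
substitution `t = x²` then gives the Gaussian mean of `log x²`. -/
lemma integral_rpow_mul_log_mul_exp :
    ∫ t in Set.Ioi (0 : ℝ), t ^ (-(1 / 2) : ℝ) * (Real.log t * Real.exp (-t)) =
      -√Real.pi * (Real.eulerMascheroniConstant + 2 * Real.log 2) := by
  have h1 := Complex.hasDerivAt_GammaIntegral (s := 1 / 2) (by norm_num)
  have h2 : Complex.GammaIntegral =ᶠ[nhds (1 / 2)] Complex.Gamma := by
    have : ∀ᶠ s : ℂ in nhds (1 / 2), 0 < s.re :=
      Complex.continuous_re.continuousAt.eventually (lt_mem_nhds (by norm_num))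
    filter_upwards [this] with s hs using (Complex.Gamma_eq_integral hs).symm
  have h3 := h1.unique (Complex.hasDerivAt_Gamma_one_half.congr_of_eventuallyEq h2)
  have h4 : ∫ t in Set.Ioi (0 : ℝ), (t : ℂ) ^ ((1 / 2 : ℂ) - 1) *
      (↑(Real.log t) * ↑(Real.exp (-t))) =
      ∫ t in Set.Ioi (0 : ℝ),
        ((t ^ (-(1 / 2) : ℝ) * (Real.log t * Real.exp (-t)) : ℝ) : ℂ) := by
    refine setIntegral_congr_fun measurableSet_Ioi fun t ht => ?_
    rw [Complex.ofReal_mul, Complex.ofReal_mul, Complex.ofReal_cpow (le_of_lt ht)]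
    norm_num
  rw [h4, integral_complex_ofReal, ← Complex.ofReal_ofNat, ← Complex.ofReal_log (by norm_num)] at h3
  exact_mod_cast h3

lemma integral_log_sq_mul_exp_neg_sq :
    ∫ x : ℝ, Real.log (x ^ 2) * Real.exp (-x ^ 2) =
      -(Real.eulerMascheroniConstant + 2 * Real.log 2) * √Real.pi := by
  have h1 := integral_comp_abs (f := fun x => Real.log (x ^ 2) * Real.exp (-x ^ 2))
  simp only [sq_abs] at h1
  have h2 := integral_comp_rpow_Ioi
    (fun t : ℝ => t ^ (-(1 / 2) : ℝ) * (Real.log t * Real.exp (-t))) (p := 2) two_ne_zero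
  have h3 : ∫ x in Set.Ioi (0 : ℝ), (|(2 : ℝ)| * x ^ ((2 : ℝ) - 1)) •
      ((x ^ (2 : ℝ)) ^ (-(1 / 2) : ℝ) * (Real.log (x ^ (2 : ℝ)) * Real.exp (-x ^ (2 : ℝ)))) =
      ∫ x in Set.Ioi (0 : ℝ), 2 * (Real.log (x ^ 2) * Real.exp (-x ^ 2)) := by
    refine setIntegral_congr_fun measurableSet_Ioi fun x hx => ?_
    have hx0 : (0 : ℝ) < x := hx
    have e1 : (x ^ (2 : ℝ)) ^ (-(1 / 2) : ℝ) = x⁻¹ := by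
      rw [← Real.rpow_mul hx0.le, ← Real.rpow_neg_one]; norm_num
    have e2 : x ^ ((2 : ℝ) - 1) = x := by norm_num
    simp only [smul_eq_mul]
    rw [e1, e2, Real.rpow_two, abs_of_pos two_pos]
    field_simp
  rw [h3, integral_rpow_mul_log_mul_exp, integral_const_mul] at h2
  rw [h1, h2]
  ring

lemma integral_sq_mul_exp_neg_sq :
    ∫ x : ℝ, x ^ 2 * Real.exp (-x ^ 2) = 1 / 2 * √Real.pi := by
  have h1 := integral_comp_abs (f := fun x => x ^ 2 * Real.exp (-x ^ 2))
  simp only [sq_abs] at h1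
  have h2 := integral_rpow_mul_exp_neg_mul_rpow (p := 2) (q := 2) (b := 1) two_pos (by norm_num)
    one_pos
  have h3 : Real.Gamma ((2 + 1) / 2) = 1 / 2 * √Real.pi := by
    have := Real.Gamma_add_one (s := 1 / 2) (by norm_num)
    rw [Real.Gamma_one_half_eq] at this
    rw [← this]; norm_num
  simp only [Real.rpow_two, neg_mul, one_mul, Real.one_rpow, h3] at h2
  rw [h1, h2]
  ring

/-- The integrand is a product over coordinates. The condition `c ≠ 0` yields integrability of the
`i`-th factor, whose integral is then nonzero. -/
lemma integrable_and_integral_coord_mul_gaussian {h : ℝ → ℝ} {c : ℝ} (hc : c ≠ 0)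
    (hh : ∫ x : ℝ, h x * Real.exp (-x ^ 2) = c * √Real.pi) (i : Fin n) :
    Integrable (fun x : EuclideanSpace ℝ (Fin n) => h (x i) * Real.exp (-‖x‖ ^ 2)) ∧
      ∫ x : EuclideanSpace ℝ (Fin n), h (x i) * Real.exp (-‖x‖ ^ 2) = c * √Real.pi ^ n := by
  have hpi : 0 < √Real.pi := Real.sqrt_pos.2 Real.pi_pos
  have hG : ∫ x : ℝ, Real.exp (-x ^ 2) = √Real.pi := by
    simpa using integral_gaussian 1
  let f : Fin n → ℝ → ℝ := fun k x => (if k = i then h x else 1) * Real.exp (-x ^ 2)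
  have hf : ∀ k, ∫ x, f k x = (if k = i then c else 1) * √Real.pi := by
    intro k
    by_cases hk : k = i
    · simp only [f, hk, if_true, hh]
    · simp only [f, hk, if_false, one_mul, hG]
  have hfi : ∀ k, Integrable (f k) := fun k =>
    not_imp_comm.1 integral_undef (by rw [hf]; split_ifs <;> positivity)
  have hprod : ∀ x : EuclideanSpace ℝ (Fin n), h (x i) * Real.exp (-‖x‖ ^ 2) =
      ∏ k, f k (x.ofLp k) := by
    intro x
    simp only [f]
    rw [Finset.prod_mul_distrib, ← Real.exp_sum, Finset.prod_ite_eq' Finset.univ i,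
      if_pos (Finset.mem_univ i), EuclideanSpace.norm_sq_eq]
    simp
  have hmp := PiLp.volume_preserving_ofLp (Fin n)
  have hme : MeasurableEmbedding (WithLp.ofLp : EuclideanSpace ℝ (Fin n) → (Fin n → ℝ)) :=
    (MeasurableEquiv.toLp 2 (Fin n → ℝ)).symm.measurableEmbedding
  constructor
  · simp only [hprod]
    exact (hmp.integrable_comp_emb hme (g := fun y => ∏ k, f k (y k))).2
      (Integrable.fintype_prod hfi)
  · simp only [hprod]
    rw [hmp.integral_comp hme (fun y => ∏ k, f k (y k)), integral_fintype_prod_volume_eq_prod]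
    simp only [hf]
    rw [Finset.prod_mul_distrib, Finset.prod_ite_eq' Finset.univ i (fun _ => c),
      if_pos (Finset.mem_univ i)]
    simp

lemma integrable_and_integral_norm_sq_mul_gaussian :
    Integrable (fun x : EuclideanSpace ℝ (Fin n) => ‖x‖ ^ 2 * Real.exp (-‖x‖ ^ 2)) ∧
      ∫ x : EuclideanSpace ℝ (Fin n), ‖x‖ ^ 2 * Real.exp (-‖x‖ ^ 2) = n / 2 * √Real.pi ^ n := by
  have h := fun i : Fin n => integrable_and_integral_coord_mul_gaussian (h := fun x => x ^ 2)
    (by norm_num) integral_sq_mul_exp_neg_sq i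
  have e : ∀ x : EuclideanSpace ℝ (Fin n), ‖x‖ ^ 2 * Real.exp (-‖x‖ ^ 2) =
      ∑ i, x i ^ 2 * Real.exp (-‖x‖ ^ 2) := fun x => by
    rw [← Finset.sum_mul]
    congr 1
    rw [EuclideanSpace.norm_sq_eq]
    simp
  simp only [e]
  refine ⟨integrable_finsetSum _ fun i _ => (h i).1, ?_⟩
  rw [integral_finsetSum _ fun i _ => (h i).1]
  simp only [(h _).2]
  simp
  ring

lemma ae_coord_ne_zero (i : Fin n) : ∀ᵐ x : EuclideanSpace ℝ (Fin n), x i ≠ 0 := by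
  let P : EuclideanSpace ℝ (Fin n) →ₗ[ℝ] ℝ := (EuclideanSpace.proj (𝕜 := ℝ) i).toLinearMap
  have hP : ∀ x, P x = x i := fun x => rfl
  have h := Measure.addHaar_submodule (volume : Measure (EuclideanSpace ℝ (Fin n)))
    (LinearMap.ker P) (fun htop => by
      have : EuclideanSpace.single i (1 : ℝ) ∈ LinearMap.ker P := by rw [htop]; trivial
      simp [hP] at this)
  rw [ae_iff]
  convert h using 2
  ext x
  simp [hP]

/-- The normalization of a nonzero vector, as a point of the sphere. -/
lemma exists_coords_eq_normalize {x : EuclideanSpace ℝ (Fin n)} (hx : x ≠ 0) :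
    ∃ u : UnitSphere n, coords u = ‖x‖⁻¹ • x.ofLp := by
  refine ⟨⟨‖x‖⁻¹ • x, ?_⟩, rfl⟩
  simp [norm_smul, hx]

lemma integrable_log_normalize_mul_gaussian (l : Fin n → ℝ) :
    Integrable fun x : EuclideanSpace ℝ (Fin n) =>
      Real.log (∑ k, Real.exp (l k) * (‖x‖⁻¹ • x.ofLp) k ^ 2) * Real.exp (-‖x‖ ^ 2) := by
  have hc : Continuous fun u => Real.log (expForm (Matrix.diagonal l) (coords (n := n) u)) :=
    (continuous_expForm_coords _).log fun u =>
      (expForm_pos (Matrix.isSymm_diagonal l) (coords_ne_zero u)).ne'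
  obtain ⟨M, hM⟩ := isCompact_univ.exists_bound_of_continuousOn hc.continuousOn
  have hm : Measurable fun x : EuclideanSpace ℝ (Fin n) =>
      Real.log (∑ k, Real.exp (l k) * (‖x‖⁻¹ • x.ofLp) k ^ 2) := by
    simp only [Pi.smul_apply, smul_eq_mul]
    refine Measurable.log (Finset.measurable_sum _ fun k _ => ?_)
    have : Measurable fun x : EuclideanSpace ℝ (Fin n) => x.ofLp k :=
      (EuclideanSpace.proj (𝕜 := ℝ) k).continuous.measurable
    fun_prop
  -- `M` bounds the logarithm on the sphere; `max M 0` also covers `x = 0`, where the normalized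
  -- vector is `0` and `log 0 = 0`.
  refine integrable_gaussian.bdd_mul (c := max M 0) hm.aestronglyMeasurable (.of_forall fun x => ?_)
  rcases eq_or_ne x 0 with rfl | hx
  · simp
  · obtain ⟨u, hu⟩ := exists_coords_eq_normalize hx
    have := hM u trivial
    rw [expForm_diagonal, hu] at this
    exact this.trans (le_max_left _ _)

/-- Only the `i`-th term of the sum is kept, and `log ‖x‖²` is replaced by its tangent at `n / 2`,
the mean of `‖x‖²` under the normalized Gaussian weight. -/
lemma log_mul_gaussian_lower_bound (hn : 1 ≤ n) (l : Fin n → ℝ) (i : Fin n)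
    {x : EuclideanSpace ℝ (Fin n)} (hx : x i ≠ 0) :
    l i + 1 - Real.log (n / 2) + Real.log (x i ^ 2) - 2 / n * ‖x‖ ^ 2 ≤
      Real.log (∑ k, Real.exp (l k) * (‖x‖⁻¹ • x.ofLp) k ^ 2) := by
  have hn' : (0 : ℝ) < n := by exact_mod_cast hn
  have hx0 : 0 < ‖x‖ := norm_pos_iff.2 fun h => hx (by simp [h])
  have h1 : Real.exp (l i) * (‖x‖⁻¹ • x.ofLp) i ^ 2 ≤
      ∑ k, Real.exp (l k) * (‖x‖⁻¹ • x.ofLp) k ^ 2 :=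
    Finset.single_le_sum (f := fun k => Real.exp (l k) * (‖x‖⁻¹ • x.ofLp) k ^ 2)
      (fun k _ => by positivity) (Finset.mem_univ i)
  have hxi : 0 < x i ^ 2 := by positivity
  have h2 : Real.exp (l i) * (‖x‖⁻¹ • x.ofLp) i ^ 2 = Real.exp (l i) * (x i ^ 2 / ‖x‖ ^ 2) := by
    rw [Pi.smul_apply, smul_eq_mul]; field_simp
  rw [h2] at h1
  refine le_trans ?_ (Real.log_le_log (by positivity) h1)
  rw [Real.log_mul (Real.exp_pos _).ne' (by positivity), Real.log_exp,
    Real.log_div hxi.ne' (by positivity)]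
  have h3 := Real.log_le_sub_one_of_pos (x := ‖x‖ ^ 2 / (n / 2)) (by positivity)
  rw [Real.log_div (by positivity) (by positivity)] at h3
  have h4 : ‖x‖ ^ 2 / (n / 2) = 2 / n * ‖x‖ ^ 2 := by field_simp
  linarith

/-- Integrating the pointwise bound gives `l i - log n - log 2 - γ`, with `γ` Euler's constant, and
`γ < 2/3 < log 2`. -/
theorem le_avgPot_diagonal (hn : 1 ≤ n) (l : Fin n → ℝ) (i : Fin n) :
    l i - Real.log (4 * n) ≤ avgPot (Matrix.diagonal l) := by
  have hn' : (0 : ℝ) < n := by exact_mod_cast hn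
  set γ := Real.eulerMascheroniConstant
  have hγ : γ < 2 / 3 := Real.eulerMascheroniConstant_lt_two_thirds
  have hγ0 : 1 / 2 < γ := Real.one_half_lt_eulerMascheroniConstant
  have hlog2 := Real.log_two_gt_d9
  have hpi : 0 < √Real.pi ^ n := pow_pos (Real.sqrt_pos.2 Real.pi_pos) n
  set f : (Fin n → ℝ) → ℝ := fun v => Real.log (∑ k, Real.exp (l k) * v k ^ 2) with hf
  have hsphere := integral_uniformSphere_mul_gaussian hn f
  rw [integral_exp_neg_norm_sq] at hsphere
  have hpot : avgPot (Matrix.diagonal l) = ∫ u, f (coords u) ∂(uniformSphere n) := by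
    rw [avgPot]; simp only [expForm_diagonal, hf]
  obtain ⟨hi1, he1⟩ := integrable_and_integral_coord_mul_gaussian (n := n)
    (h := fun x => Real.log (x ^ 2)) (by linarith) integral_log_sq_mul_exp_neg_sq i
  obtain ⟨hi2, he2⟩ := integrable_and_integral_norm_sq_mul_gaussian (n := n)
  set C := l i + 1 - Real.log (n / 2)
  have hi0 := (integrable_gaussian (n := n)).const_mul C
  have hlow : ∫ x : EuclideanSpace ℝ (Fin n), (C * Real.exp (-‖x‖ ^ 2) +
      Real.log (x i ^ 2) * Real.exp (-‖x‖ ^ 2) - 2 / n * (‖x‖ ^ 2 * Real.exp (-‖x‖ ^ 2))) =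
      (C - (γ + 2 * Real.log 2) - 1) * √Real.pi ^ n := by
    have hi01 : Integrable fun x : EuclideanSpace ℝ (Fin n) => C * Real.exp (-‖x‖ ^ 2) +
      Real.log (x i ^ 2) * Real.exp (-‖x‖ ^ 2) := hi0.add hi1
    rw [integral_sub hi01 (hi2.const_mul _), integral_add hi0 hi1, integral_const_mul,
      integral_const_mul, integral_exp_neg_norm_sq, he1, he2]
    field_simp
    ring
  have hf_int : Integrable fun x : EuclideanSpace ℝ (Fin n) =>
      f (‖x‖⁻¹ • x.ofLp) * Real.exp (-‖x‖ ^ 2) :=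
    integrable_log_normalize_mul_gaussian l
  have key := integral_mono_ae ((hi0.add hi1).sub (hi2.const_mul (2 / (n : ℝ)))) hf_int (by
    filter_upwards [ae_coord_ne_zero i] with x hx
    have := mul_le_mul_of_nonneg_right (log_mul_gaussian_lower_bound hn l i hx)
      (Real.exp_pos (-‖x‖ ^ 2)).le
    simp only [Pi.add_apply, Pi.sub_apply]
    refine le_trans (le_of_eq ?_) this
    ring)
  rw [← hsphere, ← hpot] at key
  have key' := hlow.symm.trans_le key
  have h5 := le_of_mul_le_mul_right key' hpi
  have h6 : Real.log (4 * n) = 2 * Real.log 2 + Real.log n := by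
    rw [Real.log_mul (by norm_num) hn'.ne']
    congr 1
    rw [show (4 : ℝ) = 2 ^ 2 by norm_num, Real.log_pow]; norm_num
  have h7 : Real.log (n / 2) = Real.log n - Real.log 2 := Real.log_div hn'.ne' (by norm_num)
  simp only [C] at h5
  linarith

lemma avgPot_zero : avgPot (0 : Matrix (Fin n) (Fin n) ℝ) = 0 := by
  have : ∀ u : UnitSphere n, expForm 0 (coords u) = 1 := fun u => by
    rw [← Matrix.diagonal_zero, expForm_diagonal, ← sum_coords_sq u]
    simp
  simp [avgPot, this]

lemma dotProduct_conj_diagonal_le {U : Matrix (Fin n) (Fin n) ℝ}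
    (hU : U ∈ Matrix.orthogonalGroup (Fin n) ℝ) {l : Fin n → ℝ} {c : ℝ} (hl : ∀ k, l k ≤ c)
    (v : Fin n → ℝ) : v ⬝ᵥ ((U * Matrix.diagonal l * Uᵀ) *ᵥ v) ≤ c * (v ⬝ᵥ v) := by
  set w := Uᵀ *ᵥ v with hw
  have h1 : v ⬝ᵥ ((U * Matrix.diagonal l * Uᵀ) *ᵥ v) = ∑ k, l k * w k ^ 2 := by
    rw [← Matrix.mulVec_mulVec, ← Matrix.mulVec_mulVec, Matrix.dotProduct_mulVec,
      ← Matrix.mulVec_transpose, ← hw, dotProduct]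
    simp only [Matrix.mulVec_diagonal]
    exact Finset.sum_congr rfl fun k _ => by ring
  have h2 : v ⬝ᵥ v = ∑ k, w k ^ 2 := by
    have : w ⬝ᵥ w = v ⬝ᵥ v := by
      rw [hw, Matrix.dotProduct_mulVec, ← Matrix.mulVec_transpose, Matrix.transpose_transpose,
        Matrix.mulVec_mulVec, orthogonal_mul_transpose hU, Matrix.one_mulVec]
    rw [← this, dotProduct]
    exact Finset.sum_congr rfl fun k _ => by ring
  rw [h1, h2, Finset.mul_sum]
  exact Finset.sum_le_sum fun k _ => mul_le_mul_of_nonneg_right (hl k) (sq_nonneg _)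

/-- The potential dominates the largest eigenvalue up to `log (4 n)`. -/
theorem exists_le_avgPot (hn : 1 ≤ n) {Y : Matrix (Fin n) (Fin n) ℝ} (hY : Y.IsSymm) :
    ∃ c : ℝ, (∀ v, v ⬝ᵥ (Y *ᵥ v) ≤ c * (v ⬝ᵥ v)) ∧ c - Real.log (4 * n) ≤ avgPot Y := by
  obtain ⟨U, hU, l, rfl⟩ := exists_orthogonal_diagonal hY
  have : Nonempty (Fin n) := ⟨⟨0, hn⟩⟩
  obtain ⟨i, hi⟩ := Finite.exists_max l
  refine ⟨l i, dotProduct_conj_diagonal_le hU hi, ?_⟩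
  rw [avgPot_conj hn hU]
  exact le_avgPot_diagonal hn l i

/-- The terms in `p̄(Y)` and `⟨Y, P̄(Y)⟩` cancel, and `p̄(0) = 0`. -/
theorem bregman_zero_sub_bregman_le (hn : 1 ≤ n) {Y Y' : Matrix (Fin n) (Fin n) ℝ}
    (hY : Y.IsSymm) (hY' : Y'.IsSymm) :
    bregman Y 0 - bregman Y Y' ≤ Real.log (4 * n) := by
  obtain ⟨c, hc, hpot⟩ := exists_le_avgPot hn hY'
  have h1 := dPot_le hn hY (B := Y') (c := c) fun v hv => by simpa [hv] using hc v
  rw [dPot_eq_frobInner hn hY hY'] at h1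
  rw [bregman, bregman, avgPot_zero]
  have h2 : frobInner (Y' - Y) (avgProj Y) - frobInner (0 - Y) (avgProj Y) =
      frobInner Y' (avgProj Y) := by
    simp [frobInner, Matrix.sub_mul]
  linarith

/-! ### Surjectivity by minimizing a penalized potential. -/

lemma trace_mul_nonneg_of_forms {A M : Matrix (Fin n) (Fin n) ℝ} (hM : M.IsSymm)
    (hA : ∀ v, 0 ≤ v ⬝ᵥ (A *ᵥ v)) (hMp : ∀ v, 0 ≤ v ⬝ᵥ (M *ᵥ v)) : 0 ≤ (A * M).trace := by
  have hAp : ∀ U : Matrix (Fin n) (Fin n) ℝ, ∀ k, (Uᵀ * A * U) k k = Uᵀ k ⬝ᵥ (A *ᵥ Uᵀ k) :=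
    fun U k => by rw [Matrix.dotProduct_mulVec]; rfl
  obtain ⟨U, hU, l, rfl⟩ := exists_orthogonal_diagonal hM
  have hUU := orthogonal_transpose_mul hU
  have hl : ∀ k, 0 ≤ l k := by
    intro k
    have h := hMp (Uᵀ k)
    have h1 : Uᵀ k ⬝ᵥ ((U * Matrix.diagonal l * Uᵀ) *ᵥ Uᵀ k) =
        (Uᵀ * (U * Matrix.diagonal l * Uᵀ) * U) k k := by rw [Matrix.dotProduct_mulVec]; rfl
    have h2 : Uᵀ * (U * Matrix.diagonal l * Uᵀ) * U = Matrix.diagonal l := by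
      calc _ = (Uᵀ * U) * Matrix.diagonal l * (Uᵀ * U) := by simp only [Matrix.mul_assoc]
        _ = _ := by rw [hUU]; simp
    rwa [h1, h2, Matrix.diagonal_apply_eq] at h
  have h3 : (A * (U * Matrix.diagonal l * Uᵀ)).trace = ∑ k, (Uᵀ * A * U) k k * l k := by
    rw [← Matrix.mul_assoc, Matrix.trace_mul_comm, ← Matrix.mul_assoc, ← Matrix.mul_assoc,
      Matrix.trace]
    exact Finset.sum_congr rfl fun k _ => by rw [Matrix.diag_apply, Matrix.mul_diagonal]
  rw [h3]
  exact Finset.sum_nonneg fun k _ => mul_nonneg (by rw [hAp]; exact hA _) (hl k)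

/-- Testing on `e_i ± e_j` gives `2 |M i j| ≤ M i i + M j j`. -/
lemma abs_apply_le_trace {M : Matrix (Fin n) (Fin n) ℝ} (hM : M.IsSymm)
    (hMp : ∀ v, 0 ≤ v ⬝ᵥ (M *ᵥ v)) (i j : Fin n) : |M i j| ≤ M.trace := by
  have hd : ∀ k, 0 ≤ M k k := fun k => by simpa using hMp (Pi.single k 1)
  have hk : ∀ k, M k k ≤ M.trace := fun k =>
    Finset.single_le_sum (f := fun k => M k k) (fun k _ => hd k) (Finset.mem_univ k)
  have h1 := hMp (Pi.single i 1 + Pi.single j 1)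
  have h2 := hMp (Pi.single i 1 - Pi.single j 1)
  have hs := hM.apply i j
  simp [Matrix.mulVec_add, Matrix.mulVec_sub] at h1 h2
  rw [abs_le]
  constructor <;> linarith [hk i, hk j]

/-- A relative interior point can be pushed slightly away from the center `I / n` without leaving
the spectrahedron, so `(1 + t) X - (t / n) I ≽ 0` for some `t > 0`. -/
lemma exists_sub_smul_one_of_mem_intrinsicInterior (hn : 1 ≤ n) {X : Matrix (Fin n) (Fin n) ℝ}
    (hX : X ∈ intrinsicInterior ℝ (spectrahedron n)) :
    ∃ m : ℝ, 0 < m ∧ ∀ v, m * (v ⬝ᵥ v) ≤ v ⬝ᵥ (X *ᵥ v) := by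
  have hn' : (0 : ℝ) < n := by exact_mod_cast hn
  have hXm : X ∈ spectrahedron n := intrinsicInterior_subset hX
  have hc : ((n : ℝ)⁻¹ • (1 : Matrix (Fin n) (Fin n) ℝ)) ∈ spectrahedron n := by
    refine ⟨Matrix.PosSemidef.one.smul (inv_nonneg.2 hn'.le), ?_⟩
    rw [Matrix.trace_smul, Matrix.trace_one, Fintype.card_fin, smul_eq_mul, inv_mul_cancel₀ hn'.ne']
  obtain ⟨y, hy, hyX⟩ := mem_intrinsicInterior.1 hX
  let z : ℝ → affineSpan ℝ (spectrahedron n) := fun t =>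
    ⟨AffineMap.lineMap X ((n : ℝ)⁻¹ • (1 : Matrix (Fin n) (Fin n) ℝ)) (-t),
      AffineMap.lineMap_mem _ (subset_affineSpan ℝ _ hXm) (subset_affineSpan ℝ _ hc)⟩
  have hz : Continuous z := by
    refine Continuous.subtype_mk ?_ _
    simp only [AffineMap.lineMap_apply, vsub_eq_sub, vadd_eq_add]
    fun_prop
  have hz0 : z 0 = y := Subtype.ext (by simp [z, hyX])
  have hev : ∀ᶠ t in nhds (0 : ℝ), z t ∈ interior (Subtype.val ⁻¹' spectrahedron n) :=
    hz.continuousAt.eventually (isOpen_interior.mem_nhds (by rwa [hz0]))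
  obtain ⟨t, ht, ht0⟩ := ((hev.filter_mono (nhdsWithin_le_nhds (s := Set.Ioi 0))).and
    self_mem_nhdsWithin).exists
  have ht0' : 0 < t := ht0
  have hmem : (z t : Matrix (Fin n) (Fin n) ℝ) ∈ spectrahedron n :=
    interior_subset (s := Subtype.val ⁻¹' spectrahedron n) ht
  have hzt : (z t : Matrix (Fin n) (Fin n) ℝ) = (1 + t) • X - (t * (n : ℝ)⁻¹) • 1 := by
    simp only [z, AffineMap.lineMap_apply, vsub_eq_sub, vadd_eq_add]
    module
  refine ⟨t * (n : ℝ)⁻¹ / (1 + t), by positivity, fun v => ?_⟩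
  have h := posSemidef_dotProduct_nonneg hmem.1 v
  rw [hzt, Matrix.sub_mulVec, Matrix.smul_mulVec, Matrix.smul_mulVec, Matrix.one_mulVec,
    dotProduct_sub, dotProduct_smul, dotProduct_smul, smul_eq_mul, smul_eq_mul] at h
  rw [div_mul_eq_mul_div, div_le_iff₀ (by positivity)]
  linarith

/-- The penalized objective whose minimizer is sent to `X` by the mirror projection. -/
def penalizedPot (X Y : Matrix (Fin n) (Fin n) ℝ) : ℝ :=
  symPot Y - (X * Y).trace + 1 / 2 * Y.trace ^ 2

lemma continuous_penalizedPot (X : Matrix (Fin n) (Fin n) ℝ) : Continuous (penalizedPot X) := by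
  unfold penalizedPot
  have h1 : Continuous fun Y : Matrix (Fin n) (Fin n) ℝ => (X * Y).trace :=
    (continuous_const.mul continuous_id).matrix_trace
  have h2 : Continuous fun Y : Matrix (Fin n) (Fin n) ℝ => Y.trace := continuous_id.matrix_trace
  exact (continuous_symPot.sub h1).add ((h2.pow 2).const_mul _)

/-- Coercivity. With `M = c I - Y ≽ 0` and `p̄(Y) ≥ c - L`, the objective is at least `m tr M + (tr
Y)² / 2 - L`. Nonpositivity bounds both traces, then `c` through `c n = tr M + tr Y`, and finally
the entries. -/
lemma abs_apply_le_of_penalizedPot_nonpos (hn : 1 ≤ n) {X : Matrix (Fin n) (Fin n) ℝ}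
    (hXt : X.trace = 1) {m : ℝ} (hm : 0 < m) (hX : ∀ v, m * (v ⬝ᵥ v) ≤ v ⬝ᵥ (X *ᵥ v))
    {Y : Matrix (Fin n) (Fin n) ℝ} (hY : Y.IsSymm) (hle : penalizedPot X Y ≤ 0) (i j : Fin n) :
    |Y i j| ≤ 2 * (Real.log (4 * n) / m) + 2 * Real.log (4 * n) + 1 := by
  have hn' : (1 : ℝ) ≤ n := by exact_mod_cast hn
  obtain ⟨c, hc, hpot⟩ := exists_le_avgPot hn hY
  set L := Real.log (4 * n)
  have hL : 0 ≤ L := Real.log_nonneg (by linarith)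
  set M := c • (1 : Matrix (Fin n) (Fin n) ℝ) - Y with hMdef
  have hMs : M.IsSymm := ((Matrix.isSymm_one).smul c).sub hY
  have hMp : ∀ v, 0 ≤ v ⬝ᵥ (M *ᵥ v) := fun v => by
    rw [hMdef, Matrix.sub_mulVec, Matrix.smul_mulVec, Matrix.one_mulVec, dotProduct_sub,
      dotProduct_smul, smul_eq_mul]
    linarith [hc v]
  have h1 := trace_mul_nonneg_of_forms (A := X - m • 1) hMs (fun v => by
    rw [Matrix.sub_mulVec, Matrix.smul_mulVec, Matrix.one_mulVec, dotProduct_sub,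
      dotProduct_smul, smul_eq_mul]
    linarith [hX v]) hMp
  rw [Matrix.sub_mul, Matrix.smul_mul, Matrix.one_mul, Matrix.trace_sub, Matrix.trace_smul,
    smul_eq_mul] at h1
  have h2 : (X * M).trace = c - (X * Y).trace := by
    rw [hMdef, Matrix.mul_sub, Matrix.mul_smul, Matrix.mul_one, Matrix.trace_sub,
      Matrix.trace_smul, hXt, smul_eq_mul, mul_one]
  have h3 : M.trace = c * n - Y.trace := by
    rw [hMdef, Matrix.trace_sub, Matrix.trace_smul, Matrix.trace_one, Fintype.card_fin, smul_eq_mul]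
  rw [penalizedPot, symPot_eq hY] at hle
  have hMt : 0 ≤ M.trace := (abs_nonneg _).trans (abs_apply_le_trace hMs hMp i j)
  have hmM : 0 ≤ m * M.trace := by positivity
  have h4 : M.trace ≤ L / m := by
    rw [le_div_iff₀ hm]
    nlinarith [sq_nonneg Y.trace]
  have h5 : Y.trace ^ 2 ≤ 2 * L := by linarith
  -- The `+ 1` avoids a square root: `s² ≤ 2 L` implies `|s| ≤ 2 L + 1`.
  have h6 : |Y.trace| ≤ 2 * L + 1 := abs_le.2 ⟨by nlinarith, by nlinarith⟩
  have h7 : |c| ≤ L / m + (2 * L + 1) := by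
    have e : |c * n| ≤ L / m + (2 * L + 1) := by
      have : c * n = M.trace + Y.trace := by rw [h3]; ring
      rw [this]
      refine (abs_add_le _ _).trans (add_le_add ?_ h6)
      rwa [abs_of_nonneg hMt]
    rw [abs_mul, abs_of_pos (by linarith : (0 : ℝ) < n)] at e
    nlinarith [abs_nonneg c]
  have h8 : Y i j = c * (1 : Matrix (Fin n) (Fin n) ℝ) i j - M i j := by
    simp [hMdef]
  have h9 : |c * (1 : Matrix (Fin n) (Fin n) ℝ) i j| ≤ |c| := by
    rw [Matrix.one_apply]
    split_ifs <;> simp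
  rw [h8]
  refine (abs_sub _ _).trans ?_
  linarith [abs_apply_le_trace hMs hMp i j]

/-- The sublevel set at `0` is compact and contains `Y = 0`, where the objective vanishes; outside
it the objective is positive. -/
lemma exists_isMin_penalizedPot (hn : 1 ≤ n) {X : Matrix (Fin n) (Fin n) ℝ}
    (hXt : X.trace = 1) {m : ℝ} (hm : 0 < m) (hX : ∀ v, m * (v ⬝ᵥ v) ≤ v ⬝ᵥ (X *ᵥ v)) :
    ∃ Y : Matrix (Fin n) (Fin n) ℝ, Y.IsSymm ∧
      ∀ Z : Matrix (Fin n) (Fin n) ℝ, Z.IsSymm → penalizedPot X Y ≤ penalizedPot X Z := by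
  set R := 2 * (Real.log (4 * n) / m) + 2 * Real.log (4 * n) + 1
  set K : Set (Matrix (Fin n) (Fin n) ℝ) := {Y | Y.IsSymm ∧ penalizedPot X Y ≤ 0}
  have hKc : IsClosed K :=
    (isClosed_eq continuous_id.matrix_transpose continuous_id).inter
      (isClosed_le (continuous_penalizedPot X) continuous_const)
  have hB : IsCompact {Y : Matrix (Fin n) (Fin n) ℝ | ∀ i j, Y i j ∈ Set.Icc (-R) R} := by
    have := isCompact_univ_pi fun _ : Fin n => isCompact_univ_pi fun _ : Fin n =>
      isCompact_Icc (a := -R) (b := R)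
    refine this.of_isClosed_subset ?_ fun Y hY i _ j _ => hY i j
    simp only [Set.ofPred_forall]
    exact isClosed_iInter fun i => isClosed_iInter fun j =>
      isClosed_Icc.preimage (continuous_id.matrix_elem i j)
  have hK : IsCompact K := hB.of_isClosed_subset hKc fun Y hY i j =>
    abs_le.1 (abs_apply_le_of_penalizedPot_nonpos hn hXt hm hX hY.1 hY.2 i j)
  have h0 : penalizedPot X 0 = 0 := by
    rw [penalizedPot, symPot_eq Matrix.isSymm_zero, avgPot_zero]
    simp
  have h0K : (0 : Matrix (Fin n) (Fin n) ℝ) ∈ K := ⟨Matrix.isSymm_zero, h0.le⟩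
  obtain ⟨Y, hY, hmin⟩ := hK.exists_isMinOn ⟨0, h0K⟩ (continuous_penalizedPot X).continuousOn
  refine ⟨Y, hY.1, fun Z hZ => ?_⟩
  by_cases hZK : penalizedPot X Z ≤ 0
  · exact hmin ⟨hZ, hZK⟩
  · exact hY.2.trans (not_le.1 hZK).le

/-- This says `tr P̄(Y) = 1`. -/
lemma dPot_one (hn : 1 ≤ n) {Y : Matrix (Fin n) (Fin n) ℝ} (hY : Y.IsSymm) : dPot Y 1 = 1 := by
  refine le_antisymm (dPot_le hn hY fun v hv => by simp [hv]) ?_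
  have := dPot_le hn hY (B := -1) (c := -1) fun v hv => by simp [Matrix.neg_mulVec, hv]
  rw [map_neg] at this
  linarith

theorem exists_avgProj_eq (hn : 1 ≤ n) {X : Matrix (Fin n) (Fin n) ℝ}
    (hX : X ∈ intrinsicInterior ℝ (spectrahedron n)) :
    ∃ Y : Matrix (Fin n) (Fin n) ℝ, Y.IsSymm ∧ avgProj Y = X := by
  have hn' : (n : ℝ) ≠ 0 := by exact_mod_cast (by omega : n ≠ 0)
  obtain ⟨hXp, hXt⟩ : X ∈ spectrahedron n := intrinsicInterior_subset hX
  have hXs := isSymm_of_posSemidef hXp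
  obtain ⟨m, hm, hXm⟩ := exists_sub_smul_one_of_mem_intrinsicInterior hn hX
  obtain ⟨Y, hY, hmin⟩ := exists_isMin_penalizedPot hn hXt hm hXm
  refine ⟨Y, hY, ?_⟩
  have hgrad : ∀ D : Matrix (Fin n) (Fin n) ℝ, D.IsSymm →
      dPot Y D - (X * D).trace + Y.trace * D.trace = 0 := by
    intro D hD
    have h1 := hasDerivAt_symPot_line Y D 0
    have h2 : HasDerivAt (fun t : ℝ => (X * Y).trace + t * (X * D).trace) ((X * D).trace) 0 := by
      simpa using ((hasDerivAt_id (0 : ℝ)).mul_const (X * D).trace).const_add (X * Y).trace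
    have h3 : HasDerivAt (fun t : ℝ => Y.trace + t * D.trace) D.trace 0 := by
      simpa using ((hasDerivAt_id (0 : ℝ)).mul_const D.trace).const_add Y.trace
    have h4 := (h1.sub h2).add ((h3.pow 2).const_mul (1 / 2))
    have h5 : ∀ t : ℝ, penalizedPot X (Y + t • D) = symPot (Y + t • D) -
        ((X * Y).trace + t * (X * D).trace) + 1 / 2 * (Y.trace + t * D.trace) ^ 2 := by
      intro t
      simp [penalizedPot, Matrix.mul_add, Matrix.trace_add]
    have h6 : IsLocalMin (fun t : ℝ => penalizedPot X (Y + t • D)) 0 :=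
      Filter.Eventually.of_forall fun t => by
        simpa using hmin _ (isSymm_add_smul hY hD t)
    have h7 : HasDerivAt (fun t : ℝ => penalizedPot X (Y + t • D))
        (dPot Y D - (X * D).trace + Y.trace * D.trace) 0 := by
      simp only [h5]
      refine h4.congr_deriv ?_
      simp only [zero_smul, add_zero, zero_mul]
      norm_num
      ring
    exact h6.hasDerivAt_eq_zero h7
  -- In the identity direction `tr P̄(Y)` and `tr X` cancel, so only the penalty term `n tr Y`
  -- remains.
  have htr : Y.trace = 0 := by
    have h := hgrad 1 Matrix.isSymm_one
    rw [dPot_one hn hY, Matrix.mul_one, hXt, Matrix.trace_one, Fintype.card_fin] at h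
    have : Y.trace * n = 0 := by linarith
    exact (mul_eq_zero.1 this).resolve_right hn'
  have hPs := isSymm_avgProj hn hY
  -- The direction `P̄(Y) - X` turns the gradient equation into the vanishing of its squared
  -- Frobenius norm.
  have h := hgrad _ (hPs.sub hXs)
  rw [htr, zero_mul, add_zero, dPot_eq_trace hn hY, Matrix.trace_mul_comm X, ← Matrix.trace_sub,
    ← Matrix.mul_sub] at h
  have h2 : ((avgProj Y - X)ᴴ * (avgProj Y - X)).trace = 0 := by
    rwa [Matrix.conjTranspose_eq_transpose_of_trivial, (hPs.sub hXs).eq]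
  exact sub_eq_zero.1 (Matrix.trace_conjTranspose_mul_self_eq_zero_iff.1 h2)

end AvgMirror

end

theorem proposition1 (n : ℕ) (hn : 1 ≤ n) :
    -- smoothness
    (∀ Y D : Matrix (Fin n) (Fin n) ℝ, Y.IsSymm → D.IsSymm →
      AvgMirror.bregman Y (Y + D) ≤ 3 / 2 * AvgMirror.opNorm D ^ 2) ∧
    -- refined smoothness for positive shifts
    (∀ Y D : Matrix (Fin n) (Fin n) ℝ, Y.IsSymm → D.PosSemidef → AvgMirror.opNorm D ≤ 1 / 6 →
      AvgMirror.bregman Y (Y + D) ≤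
        3 * AvgMirror.opNorm D * AvgMirror.frobInner D (AvgMirror.avgProj Y)) ∧
    -- diameter bound
    (∀ Y Y' : Matrix (Fin n) (Fin n) ℝ, Y.IsSymm → Y'.IsSymm →
      AvgMirror.bregman Y 0 - AvgMirror.bregman Y Y' ≤ Real.log (4 * n)) ∧
    -- surjectivity onto the relative interior of the spectrahedron
    (∀ X ∈ intrinsicInterior ℝ (AvgMirror.spectrahedron n),
      ∃ Y : Matrix (Fin n) (Fin n) ℝ, Y.IsSymm ∧ AvgMirror.avgProj Y = X) := by
  refine ⟨fun Y D hY hD => ?_, fun Y D hY hD hDn => ?_, fun Y Y' hY hY' => ?_, fun X hX => ?_⟩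
  · refine (AvgMirror.bregman_add_le hn hY hD).trans ?_
    linarith [sq_nonneg (AvgMirror.opNorm D)]
  · exact AvgMirror.bregman_add_le_of_posSemidef hn hY hD hDn
  · exact AvgMirror.bregman_zero_sub_bregman_le hn hY hY'
  · exact AvgMirror.exists_avgProj_eq hn hX
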